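/- Let $d\in\mathbf N$ and $\mathbf R^{d+1}=\mathbf R\times\mathbf R^d$ with Lebesgue measure. Let $\kappa:(0,\infty)\to(0,\infty)$ satisfy: A1. $\kappa$ is continuous, $\lim_{\delta\to0}\kappa(\delta)=0$ and $\lim_{\delta\to\infty}\kappa(\delta)=\infty$. A2. There is a nondecreasing continuous function $l(\varepsilon)$, $\varepsilon>0$, with $\lim_{\varepsilon\to0}l(\varepsilon)=0$ and $\kappa(\varepsilon r)\le l(\varepsilon)\kappa(r)$ for all $r,\varepsilon>0$. For $\delta>0$ and $(t,x)\in\mathbf R\times\mathbf R^d$ put $Q_\delta(t,x)=(t-\kappa(\delta),t+\kappa(\delta))\times B_\delta(x)$, where $B_\delta(x)$ is the open Euclidean ball. Let $K(t,x,s,y)$ be a measurable real-valued function on $\mathbf R^{d+1}\times\mathbf R^{d+1}$ and $$(Tf)(t,x)=\int_{\mathbf R^{d+1}}K(t,x,s,y)f(s,y)\,ds\,dy .$$ Let $1<p<q\le\infty$. Assume that $T$ is defined and bounded on $L_q=L_q(\mathbf R^{d+1})$: for every $f\in L_q$ the integral converges absolutely for almost every $(t,x)$, and $$|Tf|_{L_q}\le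 C|f|_{L_q},\qquad f\in L_q .$$ Assume also the Hörmander-type condition: there are constants $c>1$ and $A\ge 0$ such that for all $\delta>0$ and all $(s,y)\in\mathbf R^{d+1}$, $$\int_{\mathbf R^{d+1}\setminus Q_{c\delta}(s,y)}|K(t,x,\bar s,\bar y)-K(t,x,s,y)|\,dx\,dt\le A\qquad\text{for all }(\bar s,\bar y)\in Q_\delta(s,y).$$ Then $T$ is bounded in $L_p$-norm on $L_p\cap L_q$: for every $f\in L_p\cap L_q$ one has $Tf\in L_p$ and $$|Tf|_{L_p}\le A_p|f|_{L_p},$$ where the constant $A_p$ depends only on $p$, on the constants $A$, $C$ and $c$ in the assumptions, on $d$ and on the function $l$ (in particular not on $f$, $K$ or $q$, and on $\kappa$ only through $l$). -/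

import Mathlib

open MeasureTheory Set Filter Topology
open scoped ENNReal NNReal

/-- The space-time `ℝ × ℝᵈ = ℝᵈ⁺¹`, a point being `(t, x)`; `ℝᵈ` carries the Euclidean norm and the
measure `volume` on the product is Lebesgue measure. -/
abbrev SpaceTime (d : ℕ) : Type := ℝ × EuclideanSpace ℝ (Fin d)

/-- The cylinder `Q_δ(t, x) = (t - κ(δ), t + κ(δ)) × B_δ(x)` with centre `z = (t, x)`. -/
def cylinder {d : ℕ} (κ : ℝ → ℝ) (δ : ℝ) (z : SpaceTime d) : Set (SpaceTime d) :=
  Ioo (z.1 - κ δ) (z.1 + κ δ) ×ˢ Metric.ball z.2 δ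

/-- Assumption A1 on a function `κ : (0, ∞) → (0, ∞)`: it is continuous, tends to `0` at `0` and
tends to `∞` at `∞`. (Only the values of `κ` on `(0, ∞)` matter.) -/
structure AssumptionA1 (κ : ℝ → ℝ) : Prop where
  pos : ∀ r, 0 < r → 0 < κ r
  continuousOn : ContinuousOn κ (Ioi 0)
  tendsto_zero : Tendsto κ (𝓝[>] 0) (𝓝 0)
  tendsto_atTop : Tendsto κ atTop atTop

/-- Assumption A2 on `κ`, with the scaling factor `l`: `l` is nondecreasing and continuous on
`(0, ∞)`, tends to `0` at `0`, and `κ(ε r) ≤ l(ε) κ(r)` for all `r, ε > 0`. -/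
structure AssumptionA2 (κ l : ℝ → ℝ) : Prop where
  monotoneOn : MonotoneOn l (Ioi 0)
  continuousOn : ContinuousOn l (Ioi 0)
  tendsto_zero : Tendsto l (𝓝[>] 0) (𝓝 0)
  scaling : ∀ r ε, 0 < r → 0 < ε → κ (ε * r) ≤ l ε * κ r

/-- The integral operator `(T f)(t, x) = ∫ K(t, x, s, y) f(s, y) ds dy`. -/
noncomputable def integralOperator {d : ℕ} (K : SpaceTime d → SpaceTime d → ℝ)
    (f : SpaceTime d → ℝ) (z : SpaceTime d) : ℝ :=
  ∫ w, K z w * f w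

/-- The integral operator with kernel `K` is defined and bounded on `L_q` with bound `C`: for each
`f ∈ L_q` the integral defining `(T f)(z)` converges absolutely for almost every `z`, and
`|T f|_{L_q} ≤ C |f|_{L_q}`. -/
def DefinedAndBoundedOn {d : ℕ} (K : SpaceTime d → SpaceTime d → ℝ) (q : ℝ≥0∞) (C : ℝ≥0) : Prop :=
  ∀ f : SpaceTime d → ℝ, MemLp f q volume →
    (∀ᵐ z : SpaceTime d, Integrable (fun w => K z w * f w) volume) ∧
      eLpNorm (integralOperator K f) q volume ≤ C * eLpNorm f q volume

/-- The Hörmander condition relative to the cylinders, with constants `c` and `A`: for every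
cylinder `Q_δ(s, y)` and every `(s', y') ∈ Q_δ(s, y)`,
`∫_{Q_{cδ}(s, y)ᶜ} |K(t, x, s', y') - K(t, x, s, y)| dt dx ≤ A`. -/
def HormanderCondition {d : ℕ} (κ : ℝ → ℝ) (K : SpaceTime d → SpaceTime d → ℝ)
    (c : ℝ) (A : ℝ≥0) : Prop :=
  ∀ δ : ℝ, 0 < δ → ∀ w : SpaceTime d, ∀ w' ∈ cylinder κ δ w,
    ∫⁻ z in (cylinder κ (c * δ) w)ᶜ, ‖K z w' - K z w‖ₑ ≤ A

/-!
The proof is the Calderón–Zygmund argument, arranged so that no constant depends on `q`.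

**Geometry.** The function `κ` need not be monotone, but the scaling condition with `l ε → 0` gives
`κ r ≤ l ε * κ s` for `r ≤ ε * s` and supplies an `N` such that dilating by `N` engulfs any
intersecting cylinder of comparable radius. Together with the doubling of volumes this is all that
Vitali's covering lemma needs. It yields the weak type bound for the maximal function over cylinders
(`volume_exists_exceedsOn_le`), hence that a function is a.e. dominated by its maximal function.

**Decomposition.** For integrable `f` and a height `α`, take disjoint stopping cylinders `B i` whose
`N`-dilates cover the set where the maximal function exceeds `α`, with mean of `|f|` at most `α` on
the dilates, and disjointify the dilates into sets `E i`. The bad part `b i` is `f` on `E i` minus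
the constant on `B i` (rather than on `E i`) that gives it mean zero. The good part is then bounded
by a multiple of `α` although the `E i` may be very small (`exists_czDecomposition`), so no dyadic
structure is needed. Since `∑ |b i| ≤ |f| + |g|` pointwise, the operator may be applied to the
series term by term, also when `q = ∞`.

**Weak type (1,1).** With `α` a small multiple of the level `s`, the bound on `L_q` applied to the
good part is a factor to the power `q`, but of a number at most `1`; the Hörmander condition
controls the bad parts off the dilated cylinders (`mul_meas_integralOperator_le`).

**Interpolation.** Marcinkiewicz's theorem has a constant that blows up as `q → p`, because it uses
the bound on `L_q` only through Chebyshev's inequality. Instead, `|u| ^ p` is a multiple of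
`∫ s ^ (p - q - 1) * min |u| s ^ q ds`. Cutting `f` at the level `γ s`, the `L_q` norm of the small
part enters without loss, and the normalizing factor `p (q - p) / q` cancels the singularity at
`q = p` as well as the growth as `q → ∞` (`lintegral_rpow_le_of_weak_of_strong`). For `q = ∞` the
small part does not contribute at all (`lintegral_rpow_le_of_weak_of_bound`).
-/

/-! ### Geometry of the cylinders -/

section Cylinders

variable {d : ℕ} {κ l : ℝ → ℝ}

namespace AssumptionA2

lemma le_mul_of_le_mul (h1 : AssumptionA1 κ) (h2 : AssumptionA2 κ l) {r s ε : ℝ} (hr : 0 < r)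
    (hs : 0 < s) (hε : 0 < ε) (h : r ≤ ε * s) : κ r ≤ l ε * κ s := by
  have h3 := h2.scaling s (r / s) hs (div_pos hr hs)
  rw [div_mul_cancel₀ _ hs.ne'] at h3
  refine h3.trans (mul_le_mul_of_nonneg_right ?_ (h1.pos s hs).le)
  exact h2.monotoneOn (div_pos hr hs) hε ((div_le_iff₀ hs).2 h)

lemma scaling_pos (h1 : AssumptionA1 κ) (h2 : AssumptionA2 κ l) {ε : ℝ} (hε : 0 < ε) :
    0 < l ε := by
  have h := h2.scaling 1 ε one_pos hε
  have h3 := h1.pos _ (by positivity : 0 < ε * 1)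
  exact pos_of_mul_pos_left (h3.trans_le h) (h1.pos 1 one_pos).le

end AssumptionA2

/-- A dilation factor large enough for the cylinders to engulf: the condition on `l` says that
`κ` grows by a factor of at least `l 2 + 1` when its argument is multiplied by `N`. -/
structure IsEngulfingFactor (l : ℝ → ℝ) (N : ℝ) : Prop where
  three_le : 3 ≤ N
  scaling : l N⁻¹ * (l 2 + 1) ≤ 1

lemma exists_isEngulfingFactor (hl : Tendsto l (𝓝[>] 0) (𝓝 0)) :
    ∃ N, IsEngulfingFactor l N := by
  have h1 : Tendsto (fun N : ℝ => l N⁻¹ * (l 2 + 1)) atTop (𝓝 (0 * (l 2 + 1))) :=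
    (hl.comp tendsto_inv_atTop_nhdsGT_zero).mul_const _
  rw [zero_mul] at h1
  obtain ⟨N, h2, h3⟩ := ((h1.eventually_le_const one_pos).and (eventually_ge_atTop 3)).exists
  exact ⟨N, h3, h2⟩

/-- A doubling constant: it bounds the ratio of the volumes of two cylinders whose radii have
ratio at most `ε`. -/
noncomputable def doublingConst (d : ℕ) (l : ℝ → ℝ) (ε : ℝ) : ℝ≥0 := Real.toNNReal (l ε * ε ^ d)

lemma volume_cylinder {r : ℝ} (hr : 0 < r) (z : SpaceTime d) :
    volume (cylinder κ r z) = ENNReal.ofReal (2 * κ r) *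
      (ENNReal.ofReal (r ^ d) * volume (Metric.ball (0 : EuclideanSpace ℝ (Fin d)) 1)) := by
  rw [_root_.cylinder, Measure.volume_eq_prod, Measure.prod_prod, Real.volume_Ioo,
    Measure.addHaar_ball_of_pos _ _ hr, finrank_euclideanSpace_fin]
  congr 2
  ring

lemma volume_cylinder_pos (h1 : AssumptionA1 κ) {r : ℝ} (hr : 0 < r) (z : SpaceTime d) :
    0 < volume (cylinder κ r z) := by
  rw [volume_cylinder hr]
  have := h1.pos r hr
  have h3 := Metric.measure_ball_pos volume (0 : EuclideanSpace ℝ (Fin d)) one_pos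
  refine ENNReal.mul_pos ?_ (ENNReal.mul_pos ?_ h3.ne').ne'
  · simpa using this
  · simpa using pow_pos hr d

lemma volume_cylinder_lt_top {r : ℝ} (hr : 0 < r) (z : SpaceTime d) :
    volume (cylinder κ r z) < ∞ := by
  rw [volume_cylinder hr]
  exact ENNReal.mul_lt_top ENNReal.ofReal_lt_top
    (ENNReal.mul_lt_top ENNReal.ofReal_lt_top measure_ball_lt_top)

lemma isOpen_cylinder (r : ℝ) (z : SpaceTime d) : IsOpen (cylinder κ r z) :=
  isOpen_Ioo.prod Metric.isOpen_ball

lemma measurableSet_cylinder (r : ℝ) (z : SpaceTime d) : MeasurableSet (cylinder κ r z) :=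
  (isOpen_cylinder r z).measurableSet

lemma mem_cylinder_self (h1 : AssumptionA1 κ) {r : ℝ} (hr : 0 < r) (z : SpaceTime d) :
    z ∈ cylinder κ r z := by
  have := h1.pos r hr
  exact ⟨⟨by linarith, by linarith⟩, Metric.mem_ball_self hr⟩

lemma volume_cylinder_le (h1 : AssumptionA1 κ) (h2 : AssumptionA2 κ l) {r s ε : ℝ} (hr : 0 < r)
    (hs : 0 < s) (hε : 0 < ε) (h : r ≤ ε * s) (z w : SpaceTime d) :
    volume (cylinder κ r z) ≤ doublingConst d l ε * volume (cylinder κ s w) := by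
  have hκ := h2.le_mul_of_le_mul h1 hr hs hε h
  have hl := h2.scaling_pos h1 hε
  have hκs := h1.pos s hs
  rw [volume_cylinder hr, volume_cylinder hs, ← mul_assoc, ← mul_assoc, ← mul_assoc]
  refine mul_le_mul_left ?_ _
  rw [mul_assoc]
  rw [doublingConst, ENNReal.ofNNReal_toNNReal, ← ENNReal.ofReal_mul' (by positivity),
    ← ENNReal.ofReal_mul' (by positivity), ← ENNReal.ofReal_mul' (by positivity)]
  apply ENNReal.ofReal_le_ofReal
  calc 2 * κ r * r ^ d ≤ 2 * (l ε * κ s) * (ε * s) ^ d := by gcongr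
    _ = _ := by ring

lemma exists_cylinder_subset (h1 : AssumptionA1 κ) {U : Set (SpaceTime d)} (hU : IsOpen U)
    {z : SpaceTime d} (hz : z ∈ U) : ∃ r > 0, cylinder κ r z ⊆ U := by
  obtain ⟨ρ, hρ, hb⟩ := Metric.isOpen_iff.1 hU z hz
  have h3 : ∀ᶠ r in 𝓝[>] (0 : ℝ), κ r < ρ := h1.tendsto_zero.eventually_lt_const hρ
  have h4 : ∀ᶠ r in 𝓝[>] (0 : ℝ), r < ρ :=
    (tendsto_id.mono_left nhdsWithin_le_nhds).eventually_lt_const hρ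
  obtain ⟨r, ⟨h5, h6⟩, h7⟩ := ((h3.and h4).and self_mem_nhdsWithin).exists
  refine ⟨r, h7, fun w hw => hb ?_⟩
  rw [← Prod.mk.eta (p := z), ← ball_prod_same]
  refine ⟨?_, Metric.ball_subset_ball h6.le hw.2⟩
  rw [Metric.mem_ball, Real.dist_eq, abs_lt]
  constructor <;> linarith [hw.1.1, hw.1.2]

/-- A cylinder lies in its dilate by an engulfing factor. This is not automatic, as `κ` need not
be monotone. -/
lemma cylinder_subset_dilate (h1 : AssumptionA1 κ) (h2 : AssumptionA2 κ l) {N : ℝ}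
    (hN : IsEngulfingFactor l N) {r : ℝ} (hr : 0 < r) (z : SpaceTime d) :
    cylinder κ r z ⊆ cylinder κ (N * r) z := by
  have hN3 := hN.three_le
  have hN0 : 0 < N := by linarith
  have h3 : κ r ≤ l N⁻¹ * κ (N * r) :=
    h2.le_mul_of_le_mul h1 hr (by positivity) (by positivity) (by field_simp; rfl)
  have h4 := hN.scaling
  have h5 := h2.scaling_pos h1 (inv_pos.2 hN0)
  have h6 := h2.scaling_pos h1 two_pos
  have h7 := h1.pos (N * r) (by positivity)
  have h8 : κ r ≤ κ (N * r) := by nlinarith [mul_pos h5 h6]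
  exact prod_mono (Ioo_subset_Ioo (by linarith) (by linarith))
    (Metric.ball_subset_ball (by nlinarith))

/-- If two cylinders meet and the first has at most twice the radius of the second, the centre of
the first lies in the dilate of the second by an engulfing factor. -/
lemma mem_dilate_of_inter_nonempty (h1 : AssumptionA1 κ) (h2 : AssumptionA2 κ l) {N : ℝ}
    (hN : IsEngulfingFactor l N) {r s : ℝ} (hr : 0 < r) (hs : 0 < s) (hrs : r ≤ 2 * s)
    {z w : SpaceTime d} (h : (cylinder κ r z ∩ cylinder κ s w).Nonempty) :
    z ∈ cylinder κ (N * s) w := by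
  have hN3 := hN.three_le
  have hN0 : 0 < N := by linarith
  have h3 : κ s ≤ l N⁻¹ * κ (N * s) :=
    h2.le_mul_of_le_mul h1 hs (by positivity) (by positivity) (by field_simp; rfl)
  have h9 : κ r ≤ l 2 * κ s := h2.le_mul_of_le_mul h1 hr hs two_pos hrs
  have h4 := hN.scaling
  have h6 := h2.scaling_pos h1 two_pos
  have h7 := h1.pos (N * s) (by positivity)
  have h8 : κ r + κ s ≤ κ (N * s) := by
    calc κ r + κ s ≤ (l 2 + 1) * κ s := by linarith
      _ ≤ (l 2 + 1) * (l N⁻¹ * κ (N * s)) := by gcongr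
      _ = (l N⁻¹ * (l 2 + 1)) * κ (N * s) := by ring
      _ ≤ 1 * κ (N * s) := by gcongr
      _ = _ := one_mul _
  obtain ⟨v, ⟨⟨ha, hb⟩, hc⟩, ⟨hd, he⟩, hf⟩ := h
  refine ⟨⟨by linarith, by linarith⟩, ?_⟩
  rw [Metric.mem_ball] at *
  calc dist z.2 w.2 ≤ dist v.2 z.2 + dist v.2 w.2 := dist_triangle_left _ _ _
    _ < N * s := by nlinarith

/-- The volume of a cylinder bounds its radius, uniformly in the centre. -/
lemma exists_radius_bound (h1 : AssumptionA1 κ) (d : ℕ) {V : ℝ≥0∞} (hV : V ≠ ∞) :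
    ∃ R : ℝ, ∀ (z : SpaceTime d) (r : ℝ), 0 < r → volume (cylinder κ r z) ≤ V → r ≤ R := by
  set v := volume (Metric.ball (0 : EuclideanSpace ℝ (Fin d)) 1) with hv
  have hv0 : 0 < v := Metric.measure_ball_pos volume _ one_pos
  have hvt : v < ∞ := measure_ball_lt_top
  have h3 : ∀ᶠ r in atTop, (V / v).toReal < κ r := h1.tendsto_atTop.eventually_gt_atTop _
  obtain ⟨R, hR⟩ := eventually_atTop.1 (h3.and (eventually_ge_atTop 1))
  refine ⟨R, fun z r hr hle => ?_⟩
  by_contra! hlt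
  obtain ⟨h4, h5⟩ := hR r hlt.le
  have h6 := h1.pos r hr
  rw [volume_cylinder hr, ← hv] at hle
  have h7 : ENNReal.ofReal (κ r) * v ≤ V := by
    refine le_trans ?_ hle
    rw [← mul_assoc]
    gcongr
    rw [← ENNReal.ofReal_mul (by positivity)]
    apply ENNReal.ofReal_le_ofReal
    have := one_le_pow₀ h5 (n := d)
    nlinarith
  rw [← ENNReal.le_div_iff_mul_le (Or.inl hv0.ne') (Or.inl hvt.ne)] at h7
  have h8 := ENNReal.toReal_mono (ENNReal.div_ne_top hV hv0.ne') h7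
  rw [ENNReal.toReal_ofReal h6.le] at h8
  linarith

/-! ### Stopping-time cylinders -/

/-- The mean of `h` over the cylinder of radius `r` about `z` exceeds `α`; the inequality is
multiplied through by the volume of the cylinder. -/
def ExceedsOn (κ : ℝ → ℝ) (h : SpaceTime d → ℝ≥0∞) (α : ℝ≥0∞) (z : SpaceTime d) (r : ℝ) : Prop :=
  α * volume (cylinder κ r z) < ∫⁻ w in cylinder κ r z, h w

/-- The radii come from almost maximal choices at each point, and the cylinders from Vitali's
covering lemma applied to these. The dilates then cover the set where the maximal function exceeds
`α`, while the mean of `h` over each dilate is at most `α`. -/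
lemma exists_stopping_cylinders (h1 : AssumptionA1 κ) (h2 : AssumptionA2 κ l) {N : ℝ}
    (hN : IsEngulfingFactor l N) {h : SpaceTime d → ℝ≥0∞} (hh : ∫⁻ w, h w ≠ ∞) {α : ℝ≥0∞}
    (hα : α ≠ 0) :
    ∃ (u : Set (SpaceTime d)) (r : SpaceTime d → ℝ), u.Countable ∧ (∀ z, 0 < r z) ∧
      u.PairwiseDisjoint (fun z => cylinder κ (r z) z) ∧
      (∀ z ∈ u, ExceedsOn κ h α z (r z)) ∧
      (∀ z ∈ u, ¬ ExceedsOn κ h α z (N * r z)) ∧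
      ∀ z s, 0 < s → ExceedsOn κ h α z s → ∃ w ∈ u, z ∈ cylinder κ (N * r w) w := by
  obtain ⟨R, hR⟩ := exists_radius_bound h1 d (ENNReal.div_ne_top hh hα)
  have hbd : ∀ z s, 0 < s → ExceedsOn κ h α z s → s ≤ R := by
    intro z s hs hz
    refine hR z s hs ?_
    rw [ENNReal.le_div_iff_mul_le (Or.inl hα) (Or.inr hh), mul_comm]
    exact hz.le.trans (setLIntegral_le_lintegral _ _)
  set F : Set (SpaceTime d) := {z | ∃ s, 0 < s ∧ ExceedsOn κ h α z s} with hF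
  have key : ∀ z, ∃ r : ℝ, 0 < r ∧
      (z ∈ F → ExceedsOn κ h α z r ∧ ∀ s, 2 * r ≤ s → ¬ ExceedsOn κ h α z s) := by
    intro z
    by_cases hz : z ∈ F
    · set S : Set ℝ := {s | 0 < s ∧ ExceedsOn κ h α z s}
      have hS : S.Nonempty := hz
      have hSb : BddAbove S := ⟨R, fun s hs => hbd z s hs.1 hs.2⟩
      have hpos : 0 < sSup S := by
        obtain ⟨s, hs⟩ := hS
        exact hs.1.trans_le (le_csSup hSb hs)
      obtain ⟨r, hr, hr2⟩ := exists_lt_of_lt_csSup hS (half_lt_self hpos)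
      refine ⟨r, hr.1, fun _ => ⟨hr.2, fun s hs hex => ?_⟩⟩
      have := le_csSup hSb (show s ∈ S from ⟨by linarith [hr.1], hex⟩)
      linarith
    · exact ⟨1, one_pos, fun h => absurd h hz⟩
  choose r hr0 hr using key
  obtain ⟨u, huF, hud, huc⟩ := Vitali.exists_disjoint_subfamily_covering_enlargement
    (fun z => cylinder κ (r z) z) F r 2 one_lt_two (fun z _ => (hr0 z).le) R
    (fun z hz => hbd z _ (hr0 z) (hr z hz).1) (fun z _ => ⟨z, mem_cylinder_self h1 (hr0 z) z⟩)
  have hN3 := hN.three_le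
  refine ⟨u, r, ?_, hr0, hud, fun z hz => (hr z (huF hz)).1, fun z hz =>
    (hr z (huF hz)).2 _ (by nlinarith [hr0 z]), fun z s hs hex => ?_⟩
  · exact hud.countable_of_isOpen (fun z _ => isOpen_cylinder _ _)
      (fun z _ => ⟨z, mem_cylinder_self h1 (hr0 z) z⟩)
  · obtain ⟨w, hw, hne, hle⟩ := huc z ⟨s, hs, hex⟩
    exact ⟨w, hw, mem_dilate_of_inter_nonempty h1 h2 hN (hr0 z) (hr0 w) hle hne⟩

/-- Disjointness of the stopping cylinders, in summed form. -/
lemma tsum_volume_stopping_le {h : SpaceTime d → ℝ≥0∞} {α : ℝ≥0∞} {u : Set (SpaceTime d)}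
    {r : SpaceTime d → ℝ} (hu : u.Countable)
    (hd : u.PairwiseDisjoint (fun z => cylinder κ (r z) z))
    (hex : ∀ z ∈ u, ExceedsOn κ h α z (r z)) :
    α * ∑' z : u, volume (cylinder κ (r z) (z : SpaceTime d)) ≤ ∫⁻ w, h w := by
  have := hu.to_subtype
  rw [← ENNReal.tsum_mul_left]
  calc ∑' z : u, α * volume (cylinder κ (r z) (z : SpaceTime d))
      ≤ ∑' z : u, ∫⁻ w in cylinder κ (r z) (z : SpaceTime d), h w :=
        ENNReal.tsum_le_tsum fun z => (hex z z.2).le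
    _ = ∫⁻ w in ⋃ z : u, cylinder κ (r z) (z : SpaceTime d), h w :=
        (lintegral_iUnion (fun z => measurableSet_cylinder _ _) (hd.subtype _ _) _).symm
    _ ≤ _ := setLIntegral_le_lintegral _ _

/-- The weak-type bound for the centred maximal function over cylinders. -/
lemma volume_exists_exceedsOn_le (h1 : AssumptionA1 κ) (h2 : AssumptionA2 κ l) {N : ℝ}
    (hN : IsEngulfingFactor l N) (h : SpaceTime d → ℝ≥0∞) {α : ℝ≥0∞} (hα : α ≠ 0) :
    α * volume {z | ∃ s, 0 < s ∧ ExceedsOn κ h α z s} ≤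
      doublingConst d l N * ∫⁻ w, h w := by
  have hN3 := hN.three_le
  by_cases hh : ∫⁻ w, h w = ∞
  -- The right-hand side is infinite, since the doubling constant is positive.
  · rw [hh, ENNReal.mul_top]
    · exact le_top
    · have := h2.scaling_pos h1 (show 0 < N by linarith)
      have h3 : (0 : ℝ) < l N * N ^ d := by positivity
      simpa [doublingConst] using h3
  obtain ⟨u, r, hu, hr0, hud, hex, -, hcov⟩ := exists_stopping_cylinders h1 h2 hN hh hα
  have := hu.to_subtype
  calc α * volume {z | ∃ s, 0 < s ∧ ExceedsOn κ h α z s}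
      ≤ α * volume (⋃ w : u, cylinder κ (N * r w) (w : SpaceTime d)) := by
        gcongr
        rintro z ⟨s, hs, hz⟩
        obtain ⟨w, hw, hzw⟩ := hcov z s hs hz
        exact mem_iUnion.2 ⟨⟨w, hw⟩, hzw⟩
    _ ≤ α * ∑' w : u, volume (cylinder κ (N * r w) (w : SpaceTime d)) := by
        gcongr
        exact measure_iUnion_le _
    _ ≤ α * ∑' w : u, doublingConst d l N * volume (cylinder κ (r w) (w : SpaceTime d)) := by
        gcongr with w
        have := hr0 w
        exact volume_cylinder_le h1 h2 (by positivity) this (by linarith) le_rfl _ _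
    _ = doublingConst d l N * (α * ∑' w : u, volume (cylinder κ (r w) (w : SpaceTime d))) := by
        rw [ENNReal.tsum_mul_left, mul_left_comm]
    _ ≤ _ := by
        gcongr
        exact tsum_volume_stopping_le hu hud hex

/-- Lebesgue differentiation in the form needed for the good part: almost everywhere, a function
is bounded by its maximal function. The weak-type bound reduces this to continuous functions. -/
lemma ae_enorm_le_of_forall_not_exceedsOn (h1 : AssumptionA1 κ) (h2 : AssumptionA2 κ l) {N : ℝ}
    (hN : IsEngulfingFactor l N) {f : SpaceTime d → ℝ} (hf : Integrable f) (α : ℝ≥0) :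
    ∀ᵐ z, (∀ s, 0 < s → ¬ ExceedsOn κ (fun w => ‖f w‖ₑ) α z s) → ‖f z‖ₑ ≤ α := by
  set G : Set (SpaceTime d) := {z | ∀ s, 0 < s → ¬ ExceedsOn κ (fun w => ‖f w‖ₑ) α z s}
  have main : ∀ η : ℝ≥0, 0 < η → volume {z | z ∈ G ∧ (α : ℝ≥0∞) + 3 * η < ‖f z‖ₑ} = 0 := by
    intro η hη
    have hη0 : (η : ℝ≥0∞) ≠ 0 := by exact_mod_cast hη.ne'
    have bound : ∀ ε : ℝ≥0∞, ε ≠ 0 → η * volume {z | z ∈ G ∧ (α : ℝ≥0∞) + 3 * η < ‖f z‖ₑ} ≤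
        (1 + doublingConst d l N) * ε := by
      intro ε hε
      obtain ⟨g, -, hg, hgc, hgi⟩ := hf.exists_hasCompactSupport_lintegral_sub_le hε
      have hsub : {z | z ∈ G ∧ (α : ℝ≥0∞) + 3 * η < ‖f z‖ₑ} ⊆
          {z | (η : ℝ≥0∞) ≤ ‖f z - g z‖ₑ} ∪
            {z | ∃ s, 0 < s ∧ ExceedsOn κ (fun w => ‖f w - g w‖ₑ) η z s} := by
        rintro z ⟨hzG, hz⟩
        -- Otherwise the means of `|f|` and of `|f - g|` over every cylinder about `z` are at most
        -- `α` and `η`, while `|g| > α + 2η` on a small one by continuity.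
        by_contra hcon
        simp only [mem_union, mem_ofPred_eq, not_or, not_le, not_exists, not_and] at hcon
        obtain ⟨hc1, hc2⟩ := hcon
        have hgz : (α : ℝ≥0∞) + 2 * η < ‖g z‖ₑ := by
          have h3 : ‖f z‖ₑ ≤ ‖g z‖ₑ + ‖f z - g z‖ₑ := by
            calc ‖f z‖ₑ = ‖g z + (f z - g z)‖ₑ := by congr 1; ring
              _ ≤ _ := enorm_add_le _ _
          have h4 : (α : ℝ≥0∞) + 2 * η + η < ‖g z‖ₑ + η := by
            calc (α : ℝ≥0∞) + 2 * η + η = α + 3 * η := by ring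
              _ < ‖f z‖ₑ := hz
              _ ≤ ‖g z‖ₑ + ‖f z - g z‖ₑ := h3
              _ ≤ ‖g z‖ₑ + η := by gcongr
          exact lt_of_add_lt_add_right h4
        have hopen : IsOpen {w | (α : ℝ≥0∞) + 2 * η < ‖g w‖ₑ} :=
          isOpen_lt continuous_const hgc.enorm
        obtain ⟨r, hr, hsub⟩ := exists_cylinder_subset h1 hopen hgz
        have hv0 := volume_cylinder_pos h1 hr z
        have hvt := volume_cylinder_lt_top (κ := κ) hr z
        have h5 := not_lt.1 (hzG r hr)
        have h6 := not_lt.1 (hc2 r hr)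
        have h7 : ((α : ℝ≥0∞) + 2 * η) * volume (cylinder κ r z) ≤
            (α + η) * volume (cylinder κ r z) := by
          calc ((α : ℝ≥0∞) + 2 * η) * volume (cylinder κ r z)
              = ∫⁻ _ in cylinder κ r z, ((α : ℝ≥0∞) + 2 * η) := (setLIntegral_const _ _).symm
            _ ≤ ∫⁻ w in cylinder κ r z, (‖f w‖ₑ + ‖f w - g w‖ₑ) := by
                refine setLIntegral_mono' (measurableSet_cylinder _ _) fun w hw => ?_
                refine (hsub hw).le.trans ?_
                calc ‖g w‖ₑ = ‖f w - (f w - g w)‖ₑ := by congr 1; ring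
                  _ ≤ _ := enorm_sub_le
            _ = (∫⁻ w in cylinder κ r z, ‖f w‖ₑ) + ∫⁻ w in cylinder κ r z, ‖f w - g w‖ₑ :=
                lintegral_add_left' hf.1.enorm.restrict _
            _ ≤ α * volume (cylinder κ r z) + η * volume (cylinder κ r z) := add_le_add h5 h6
            _ = _ := by ring
        rw [ENNReal.mul_le_mul_iff_left hv0.ne' hvt.ne] at h7
        norm_cast at h7
        have h8 : α + 2 * η ≤ α + η := h7
        have h9 : (α : ℝ) + 2 * η ≤ α + η := by exact_mod_cast h8
        have : (0 : ℝ) < η := by exact_mod_cast hη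
        linarith
      calc η * volume {z | z ∈ G ∧ (α : ℝ≥0∞) + 3 * η < ‖f z‖ₑ}
          ≤ η * (volume {z | (η : ℝ≥0∞) ≤ ‖f z - g z‖ₑ} +
            volume {z | ∃ s, 0 < s ∧ ExceedsOn κ (fun w => ‖f w - g w‖ₑ) η z s}) := by
            gcongr
            exact (measure_mono hsub).trans (measure_union_le _ _)
        _ = η * volume {z | (η : ℝ≥0∞) ≤ ‖f z - g z‖ₑ} +
            η * volume {z | ∃ s, 0 < s ∧ ExceedsOn κ (fun w => ‖f w - g w‖ₑ) η z s} :=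
            mul_add _ _ _
        _ ≤ (∫⁻ w, ‖f w - g w‖ₑ) + doublingConst d l N * ∫⁻ w, ‖f w - g w‖ₑ := by
            exact add_le_add (mul_meas_ge_le_lintegral₀ (hf.1.sub hgi.1).enorm _)
              (volume_exists_exceedsOn_le h1 h2 hN _ hη0)
        _ ≤ ε + doublingConst d l N * ε := by gcongr
        _ = _ := by ring
    -- The bound holds for every `ε`, which forces the left-hand side to vanish.
    by_contra hne
    have hpos : 0 < η * volume {z | z ∈ G ∧ (α : ℝ≥0∞) + 3 * η < ‖f z‖ₑ} :=
      ENNReal.mul_pos hη0 hne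
    obtain ⟨ε, hε, hlt⟩ := exists_between hpos
    set D : ℝ≥0∞ := 1 + doublingConst d l N
    have hD0 : D ≠ 0 := by simp [D]
    have hDt : D ≠ ∞ := by simp [D]
    have h3 := bound (ε / D) (ENNReal.div_pos hε.ne' hDt).ne'
    rw [ENNReal.mul_div_cancel hD0 hDt] at h3
    exact absurd h3 (not_le.2 hlt)
  have hall : ∀ᵐ z, ∀ n : ℕ,
      ¬ (z ∈ G ∧ (α : ℝ≥0∞) + 3 * ((1 / (n + 1) : ℝ≥0) : ℝ≥0∞) < ‖f z‖ₑ) := by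
    rw [ae_all_iff]
    intro n
    exact measure_eq_zero_iff_ae_notMem.1 (main _ (by positivity))
  filter_upwards [hall] with z hz hzG
  have hlim : Tendsto (fun n : ℕ => (α : ℝ≥0∞) + 3 * ((1 / (n + 1) : ℝ≥0) : ℝ≥0∞)) atTop
      (𝓝 (α + 3 * ((0 : ℝ≥0) : ℝ≥0∞))) := by
    refine tendsto_const_nhds.add (ENNReal.Tendsto.const_mul ?_ (Or.inr (by simp)))
    exact ENNReal.tendsto_coe.2 tendsto_one_div_add_atTop_nhds_zero_nat
  rw [ENNReal.coe_zero, mul_zero, add_zero] at hlim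
  exact ge_of_tendsto' hlim fun n => not_lt.1 fun hlt => hz n ⟨hzG, hlt⟩

end Cylinders

/-! ### The Calderón–Zygmund decomposition -/

lemma exists_pairwise_disjoint_refinement {ι X : Type*} [Countable ι] [MeasurableSpace X]
    {P : ι → Set X} (hP : ∀ i, MeasurableSet (P i)) :
    ∃ E : ι → Set X, (∀ i, E i ⊆ P i) ∧ (∀ i, MeasurableSet (E i)) ∧
      Pairwise (Function.onFun Disjoint E) ∧ ⋃ i, E i = ⋃ i, P i := by
  obtain ⟨e, he⟩ := exists_injective_nat ι
  refine ⟨fun i => P i \ ⋃ j, ⋃ (_ : e j < e i), P j, fun i => sdiff_subset,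
    fun i => (hP i).diff (MeasurableSet.iUnion fun j => MeasurableSet.iUnion fun _ => hP j),
    ?_, ?_⟩
  · intro i j hij
    rw [Function.onFun, Set.disjoint_left]
    rintro x ⟨hxi, hxi'⟩ ⟨hxj, hxj'⟩
    simp only [mem_iUnion, not_exists] at hxi' hxj'
    rcases lt_trichotomy (e i) (e j) with h | h | h
    · exact hxj' i h hxi
    · exact hij (he h)
    · exact hxi' j h hxj
  · refine subset_antisymm (iUnion_mono fun i => sdiff_subset) fun x hx => ?_
    have hne : {i | x ∈ P i}.Nonempty := mem_iUnion.1 hx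
    obtain ⟨i, hi, hmin⟩ := exists_minimalFor_of_wellFoundedLT (fun i => x ∈ P i) e hne
    refine mem_iUnion.2 ⟨i, hi, ?_⟩
    simp only [mem_iUnion, not_exists]
    exact fun j hj hxj => absurd (hmin hxj hj.le) (not_le.2 hj)

/-- `i₀` is the index of the set containing `x`, if there is one. -/
lemma hasSum_indicator_of_pairwise_disjoint {ι X : Type*} {E : ι → Set X}
    (hE : Pairwise (Function.onFun Disjoint E)) (φ : ι → X → ℝ) (x : X) :
    ∃ i₀ : Option ι, (∀ i, x ∈ E i ↔ i₀ = some i) ∧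
      HasSum (fun i => (E i).indicator (φ i) x) (i₀.elim 0 fun i => φ i x) ∧
      ∑' i, ‖(E i).indicator (φ i) x‖ₑ = ‖i₀.elim 0 fun i => φ i x‖ₑ := by
  by_cases hx : ∃ i, x ∈ E i
  · obtain ⟨i, hi⟩ := hx
    have huniq : ∀ j, j ≠ i → x ∉ E j := fun j hj hxj =>
      Set.disjoint_left.1 (hE hj) hxj hi
    refine ⟨some i, fun j => ⟨fun hj => ?_, fun hj => ?_⟩, ?_, ?_⟩
    · by_contra hne
      exact huniq j (fun h => hne (h ▸ rfl)) hj
    · rwa [← Option.some.inj hj]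
    · have := hasSum_single (f := fun i => (E i).indicator (φ i) x) i
        (fun j hj => indicator_of_notMem (huniq j hj) _)
      simpa [indicator_of_mem hi] using this
    · rw [tsum_eq_single i fun j hj => by rw [indicator_of_notMem (huniq j hj), enorm_zero]]
      simp [indicator_of_mem hi]
  · push Not at hx
    refine ⟨none, fun j => by simp [hx j], ?_, ?_⟩
    · simp [indicator_of_notMem (hx _), hasSum_zero]
    · simp [indicator_of_notMem (hx _)]

/-- The Calderón–Zygmund decomposition `f = g + ∑ b i` at height `α`, with good part `g` and bad
parts `b i` of mean zero, each supported in a cylinder. -/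
structure CZDecomposition {d : ℕ} (κ : ℝ → ℝ) (D : ℝ≥0) (f : SpaceTime d → ℝ) (α : ℝ≥0)
    (u : Set (SpaceTime d)) (δ : SpaceTime d → ℝ) (g : SpaceTime d → ℝ)
    (b : u → SpaceTime d → ℝ) : Prop where
  countable : u.Countable
  radius_pos : ∀ w, 0 < δ w
  good_meas : AEStronglyMeasurable g
  good_le : ∀ᵐ w, ‖g w‖ₑ ≤ D * α
  lintegral_good_le : ∫⁻ w, ‖g w‖ₑ ≤ ∫⁻ w, ‖f w‖ₑ
  bad_integrable : ∀ i, Integrable (b i)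
  bad_support : ∀ i : u, ∀ w ∉ cylinder κ (δ i) (i : SpaceTime d), b i w = 0
  integral_bad : ∀ i, ∫ w, b i w = 0
  hasSum_bad : ∀ w, HasSum (fun i => b i w) (f w - g w)
  tsum_bad_le : ∀ w, ∑' i, ‖b i w‖ₑ ≤ ‖f w‖ₑ + ‖g w‖ₑ
  lintegral_bad_le : ∑' i, ∫⁻ w, ‖b i w‖ₑ ≤ 2 * ∫⁻ w, ‖f w‖ₑ
  volume_le : α * ∑' i : u, volume (cylinder κ (δ i) (i : SpaceTime d)) ≤ D * ∫⁻ w, ‖f w‖ₑ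

/-- Let `B i` be disjoint stopping cylinders, `P i` their dilates and `E i ⊆ P i` a disjointification
of the latter. The part of `f` on `E i` is balanced by a constant on `B i`; as the `B i` are
disjoint, these constants do not pile up in the good part, however small the `E i` are. -/
lemma exists_czDecomposition {d : ℕ} {κ l : ℝ → ℝ} (h1 : AssumptionA1 κ)
    (h2 : AssumptionA2 κ l) {N : ℝ} (hN : IsEngulfingFactor l N) {f : SpaceTime d → ℝ}
    (hf : Integrable f) {α : ℝ≥0} (hα : 0 < α) :
    ∃ u δ g b, CZDecomposition κ (1 + doublingConst d l N) f α u δ g b := by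
  have hN3 := hN.three_le
  have hα0 : (α : ℝ≥0∞) ≠ 0 := by exact_mod_cast hα.ne'
  obtain ⟨u, r, hu, hr0, hud, hex, hnex, hcov⟩ := exists_stopping_cylinders h1 h2 hN
    (h := fun w => ‖f w‖ₑ) hf.2.ne hα0
  have := hu.to_subtype
  have hδ0 : ∀ w, 0 < N * r w := fun w => by have := hr0 w; positivity
  set B : u → Set (SpaceTime d) := fun i => cylinder κ (r i) (i : SpaceTime d) with hB
  set P : u → Set (SpaceTime d) := fun i => cylinder κ (N * r i) (i : SpaceTime d) with hP
  have hBP : ∀ i, B i ⊆ P i := fun i => cylinder_subset_dilate h1 h2 hN (hr0 i) _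
  have hBd : Pairwise (Function.onFun Disjoint B) := hud.subtype _ _
  have hBm : ∀ i, MeasurableSet (B i) := fun i => measurableSet_cylinder _ _
  have hB0 : ∀ i, volume (B i) ≠ 0 := fun i => (volume_cylinder_pos h1 (hr0 i) _).ne'
  have hBt : ∀ i, volume (B i) ≠ ∞ := fun i => (volume_cylinder_lt_top (hr0 i) _).ne
  obtain ⟨E, hEP, hEm, hEd, hEU⟩ := exists_pairwise_disjoint_refinement (P := P)
    fun i => measurableSet_cylinder _ _
  set D := doublingConst d l N with hD
  have hvol : ∀ i, volume (P i) ≤ D * volume (B i) := fun i =>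
    volume_cylinder_le h1 h2 (hδ0 i) (hr0 i) (by linarith) le_rfl _ _
  -- The constant on `B i` that carries the same integral as `f` does on `E i`.
  set a : u → ℝ := fun i => (∫ w in E i, f w) / (volume (B i)).toReal with ha
  have ha1 : ∀ i, ‖a i‖ₑ * volume (B i) ≤ ∫⁻ w in E i, ‖f w‖ₑ := by
    intro i
    have h3 : a i * (volume (B i)).toReal = ∫ w in E i, f w :=
      div_mul_cancel₀ _ (ENNReal.toReal_ne_zero.2 ⟨hB0 i, hBt i⟩)
    calc ‖a i‖ₑ * volume (B i) = ‖a i * (volume (B i)).toReal‖ₑ := by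
          rw [enorm_mul, Real.enorm_of_nonneg ENNReal.toReal_nonneg, ENNReal.ofReal_toReal (hBt i)]
      _ ≤ _ := by rw [h3]; exact enorm_integral_le_lintegral_enorm _
  have ha2 : ∀ i, ‖a i‖ₑ ≤ D * α := by
    intro i
    rw [← ENNReal.mul_le_mul_iff_left (hB0 i) (hBt i)]
    calc ‖a i‖ₑ * volume (B i) ≤ ∫⁻ w in E i, ‖f w‖ₑ := ha1 i
      _ ≤ ∫⁻ w in P i, ‖f w‖ₑ := lintegral_mono_set (hEP i)
      _ ≤ α * volume (P i) := not_lt.1 (hnex i i.2)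
      _ ≤ α * (D * volume (B i)) := by gcongr; exact hvol i
      _ = _ := by ring
  set H : SpaceTime d → ℝ := fun w => ∑' i, (B i).indicator (fun _ => a i) w with hH
  set g : SpaceTime d → ℝ := fun w => (⋃ i, E i)ᶜ.indicator f w + H w with hg
  set b : u → SpaceTime d → ℝ := fun i w => (E i).indicator f w - (B i).indicator (fun _ => a i) w
    with hb
  have hUm : MeasurableSet (⋃ i, E i) := MeasurableSet.iUnion hEm
  have hHm : Measurable H := by
    refine measurable_of_tendsto_metrizable' (u := (atTop : Filter (Finset u)))
      (f := fun s w => ∑ i ∈ s, (B i).indicator (fun _ => a i) w) ?_ ?_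
    · exact fun s => Finset.measurable_fun_sum s fun i _ => measurable_const.indicator (hBm i)
    · refine tendsto_pi_nhds.2 fun w => ?_
      obtain ⟨i₀, -, hs, -⟩ := hasSum_indicator_of_pairwise_disjoint hBd (fun i _ => a i) w
      exact hs.summable.hasSum
  have hH0 : ∀ w, w ∉ ⋃ i, E i → H w = 0 := by
    intro w hw
    rw [hEU] at hw
    have : ∀ i, w ∉ B i := fun i hi => hw (mem_iUnion.2 ⟨i, hBP i hi⟩)
    simp [hH, indicator_of_notMem (this _)]
  have hHD : ∀ w, ‖H w‖ₑ ≤ D * α := by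
    intro w
    obtain ⟨i₀, -, hs, -⟩ := hasSum_indicator_of_pairwise_disjoint hBd (fun i _ => a i) w
    have : H w = i₀.elim 0 fun i => a i := hs.tsum_eq
    rw [this]
    cases i₀ with
    | none => simp
    | some i => exact ha2 i
  have hEf : ∑' i, ∫⁻ w in E i, ‖f w‖ₑ = ∫⁻ w in ⋃ i, E i, ‖f w‖ₑ :=
    (lintegral_iUnion hEm hEd _).symm
  have hBa : ∀ i, ∫⁻ w, ‖(B i).indicator (fun _ => a i) w‖ₑ ≤ ∫⁻ w in E i, ‖f w‖ₑ := by
    intro i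
    simp_rw [enorm_indicator_eq_indicator_enorm]
    rw [lintegral_indicator (hBm i), setLIntegral_const]
    exact ha1 i
  have hHint : ∫⁻ w, ‖H w‖ₑ ≤ ∫⁻ w in ⋃ i, E i, ‖f w‖ₑ := by
    calc ∫⁻ w, ‖H w‖ₑ ≤ ∫⁻ w, ∑' i, ‖(B i).indicator (fun _ => a i) w‖ₑ :=
          lintegral_mono fun w => enorm_tsum_le_tsum_enorm
      _ = ∑' i, ∫⁻ w, ‖(B i).indicator (fun _ => a i) w‖ₑ :=
          lintegral_tsum fun i => (measurable_const.indicator (hBm i)).enorm.aemeasurable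
      _ ≤ ∑' i, ∫⁻ w in E i, ‖f w‖ₑ := ENNReal.tsum_le_tsum hBa
      _ = _ := hEf
  have hsumE : ∀ w, HasSum (fun i => (E i).indicator f w) ((⋃ i, E i).indicator f w) ∧
      ∑' i, ‖(E i).indicator f w‖ₑ ≤ ‖f w‖ₑ := by
    intro w
    obtain ⟨i₀, hi, hs, hn⟩ := hasSum_indicator_of_pairwise_disjoint hEd (fun _ => f) w
    cases i₀ with
    | none =>
      have : w ∉ ⋃ i, E i := by simp [hi]
      exact ⟨by rw [indicator_of_notMem this]; exact hs, by simp [hn]⟩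
    | some i =>
      have : w ∈ ⋃ i, E i := mem_iUnion.2 ⟨i, (hi i).2 rfl⟩
      exact ⟨by rw [indicator_of_mem this]; exact hs, by simp [hn]⟩
  have hsumB : ∀ w, HasSum (fun i => (B i).indicator (fun _ => a i) w) (H w) ∧
      ∑' i, ‖(B i).indicator (fun _ => a i) w‖ₑ = ‖H w‖ₑ := by
    intro w
    obtain ⟨i₀, -, hs, hn⟩ := hasSum_indicator_of_pairwise_disjoint hBd (fun i _ => a i) w
    have : H w = i₀.elim 0 fun i => a i := hs.tsum_eq
    exact ⟨this ▸ hs, by rw [this, hn]⟩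
  refine ⟨u, fun w => N * r w, g, b, ?_⟩
  exact
  { countable := hu
    radius_pos := hδ0
    good_meas := (hf.1.indicator hUm.compl).add hHm.aestronglyMeasurable
    good_le := by
      filter_upwards [ae_enorm_le_of_forall_not_exceedsOn h1 h2 hN hf α] with w hw
      by_cases hwE : w ∈ ⋃ i, E i
      · have : g w = H w := by
          simp only [hg, indicator_of_notMem (notMem_compl_iff.2 hwE), zero_add]
        rw [this]
        refine (hHD w).trans ?_
        gcongr
        exact le_add_self
      · have : g w = f w := by
          simp only [hg, hH0 w hwE, add_zero]
          exact indicator_of_mem hwE _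
        rw [this]
        calc ‖f w‖ₑ ≤ α := hw fun s hs hsex => hwE <| by
              obtain ⟨v, hv, hwv⟩ := hcov w s hs hsex
              rw [hEU]
              exact mem_iUnion.2 ⟨⟨v, hv⟩, hwv⟩
          _ = 1 * α := (one_mul _).symm
          _ ≤ _ := by
            gcongr
            exact_mod_cast le_self_add
    lintegral_good_le := by
      calc ∫⁻ w, ‖g w‖ₑ ≤ ∫⁻ w, (‖(⋃ i, E i)ᶜ.indicator f w‖ₑ + ‖H w‖ₑ) :=
            lintegral_mono fun w => enorm_add_le _ _
        _ = (∫⁻ w in (⋃ i, E i)ᶜ, ‖f w‖ₑ) + ∫⁻ w, ‖H w‖ₑ := by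
            rw [lintegral_add_right _ hHm.enorm]
            simp_rw [enorm_indicator_eq_indicator_enorm]
            rw [lintegral_indicator hUm.compl]
        _ ≤ (∫⁻ w in (⋃ i, E i)ᶜ, ‖f w‖ₑ) + ∫⁻ w in ⋃ i, E i, ‖f w‖ₑ := by gcongr
        _ = _ := by rw [add_comm, lintegral_add_compl _ hUm]
    bad_integrable := fun i => (hf.indicator (hEm i)).sub
      ((integrable_indicator_iff (hBm i)).2 (integrableOn_const (hBt i)))
    bad_support := fun i w hw => by
      have h3 : w ∉ E i := fun h => hw (hEP i h)
      have h4 : w ∉ B i := fun h => hw (hBP i h)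
      simp [hb, h3, h4]
    integral_bad := fun i => by
      have h3 := div_mul_cancel₀ (∫ w in E i, f w) (ENNReal.toReal_ne_zero.2 ⟨hB0 i, hBt i⟩)
      rw [integral_sub (hf.indicator (hEm i))
        ((integrable_indicator_iff (hBm i)).2 (integrableOn_const (hBt i))),
        integral_indicator (hEm i), integral_indicator (hBm i), setIntegral_const,
        smul_eq_mul, mul_comm, measureReal_def, h3, sub_self]
    hasSum_bad := fun w => by
      have h3 : (⋃ i, E i).indicator f w + (⋃ i, E i)ᶜ.indicator f w = f w :=
        congrFun (indicator_self_add_compl (⋃ i, E i) f) w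
      have h4 : f w - g w = (⋃ i, E i).indicator f w - H w := by
        rw [← h3]
        simp only [hg]
        ring
      rw [h4]
      exact (hsumE w).1.sub (hsumB w).1
    tsum_bad_le := fun w => by
      by_cases hwE : w ∈ ⋃ i, E i
      · have : g w = H w := by
          simp only [hg, indicator_of_notMem (notMem_compl_iff.2 hwE), zero_add]
        calc ∑' i, ‖b i w‖ₑ
            ≤ ∑' i, (‖(E i).indicator f w‖ₑ + ‖(B i).indicator (fun _ => a i) w‖ₑ) :=
              ENNReal.tsum_le_tsum fun i => enorm_sub_le
          _ = _ := ENNReal.tsum_add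
          _ ≤ ‖f w‖ₑ + ‖g w‖ₑ := by
              rw [(hsumB w).2, this]
              gcongr
              exact (hsumE w).2
      · have h3 : ∀ i, b i w = 0 := fun i => by
          have h4 : w ∉ E i := fun h => hwE (mem_iUnion.2 ⟨i, h⟩)
          have h5 : w ∉ B i := fun h => hwE (hEU ▸ mem_iUnion.2 ⟨i, hBP i h⟩)
          simp [hb, h4, h5]
        simp [h3]
    lintegral_bad_le := by
      calc ∑' i, ∫⁻ w, ‖b i w‖ₑ
          ≤ ∑' i, ((∫⁻ w in E i, ‖f w‖ₑ) + ∫⁻ w in E i, ‖f w‖ₑ) := by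
            refine ENNReal.tsum_le_tsum fun i => ?_
            calc ∫⁻ w, ‖b i w‖ₑ
                ≤ ∫⁻ w, (‖(E i).indicator f w‖ₑ + ‖(B i).indicator (fun _ => a i) w‖ₑ) :=
                  lintegral_mono fun w => enorm_sub_le
              _ = (∫⁻ w in E i, ‖f w‖ₑ) + ∫⁻ w, ‖(B i).indicator (fun _ => a i) w‖ₑ := by
                  rw [lintegral_add_right _ (measurable_const.indicator (hBm i)).enorm]
                  congr 1
                  simp_rw [enorm_indicator_eq_indicator_enorm]
                  rw [lintegral_indicator (hEm i)]
              _ ≤ _ := add_le_add_right (hBa i) _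
        _ = 2 * ∫⁻ w in ⋃ i, E i, ‖f w‖ₑ := by rw [ENNReal.tsum_add, hEf, two_mul]
        _ ≤ _ := mul_le_mul_right (setLIntegral_le_lintegral _ _) _
    volume_le := by
      calc α * ∑' i : u, volume (P i) ≤ α * ∑' i : u, D * volume (B i) := by
            gcongr with i
            exact hvol i
        _ = D * (α * ∑' i : u, volume (B i)) := by rw [ENNReal.tsum_mul_left, mul_left_comm]
        _ ≤ ((1 + D : ℝ≥0) : ℝ≥0∞) * ∫⁻ w, ‖f w‖ₑ := by
            gcongr
            · exact le_add_self
            · exact tsum_volume_stopping_le hu hud hex }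

/-! ### The weak type (1,1) estimate -/

section WeakType

variable {d : ℕ} {κ l : ℝ → ℝ} {K : SpaceTime d → SpaceTime d → ℝ}

lemma aestronglyMeasurable_integralOperator (hK : Measurable (Function.uncurry K))
    {f : SpaceTime d → ℝ} (hf : AEStronglyMeasurable f) :
    AEStronglyMeasurable (integralOperator K f) := by
  have h3 : integralOperator K f = fun z => ∫ w, Function.uncurry K (z, w) * hf.mk f w := by
    funext z
    refine integral_congr_ae ?_
    filter_upwards [hf.ae_eq_mk] with w hw
    rw [hw]; rfl
  rw [h3]
  have h4 : StronglyMeasurable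
      (fun p : SpaceTime d × SpaceTime d => Function.uncurry K p * hf.mk f p.2) :=
    hK.stronglyMeasurable.mul (hf.stronglyMeasurable_mk.comp_measurable measurable_snd)
  exact h4.integral_prod_right'.aestronglyMeasurable

/-- Off the dilated cylinder, the vanishing mean of a bad part allows `K z w` to be replaced by
`K z w - K z w₀`. -/
lemma HormanderCondition.lintegral_integralOperator_le {c : ℝ} {A : ℝ≥0}
    (hH : HormanderCondition κ K c A) (hK : Measurable (Function.uncurry K))
    {δ : ℝ} (hδ : 0 < δ) (w₀ : SpaceTime d) {b : SpaceTime d → ℝ} (hb : Integrable b)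
    (hsupp : ∀ w ∉ cylinder κ δ w₀, b w = 0) (hb0 : ∫ w, b w = 0)
    (hint : ∀ᵐ z, Integrable (fun w => K z w * b w)) :
    ∫⁻ z in (cylinder κ (c * δ) w₀)ᶜ, ‖integralOperator K b z‖ₑ ≤ A * ∫⁻ w, ‖b w‖ₑ := by
  have hKm : Measurable fun p : SpaceTime d × SpaceTime d => K p.1 p.2 - K p.1 w₀ :=
    hK.sub (hK.comp (measurable_fst.prodMk measurable_const))
  calc ∫⁻ z in (cylinder κ (c * δ) w₀)ᶜ, ‖integralOperator K b z‖ₑ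
      ≤ ∫⁻ z in (cylinder κ (c * δ) w₀)ᶜ, ∫⁻ w, ‖K z w - K z w₀‖ₑ * ‖b w‖ₑ := by
        refine lintegral_mono_ae (ae_restrict_of_ae ?_)
        filter_upwards [hint] with z hz
        have h3 : integralOperator K b z = ∫ w, (K z w - K z w₀) * b w := by
          simp_rw [sub_mul]
          rw [integral_sub hz (hb.const_mul _), integral_const_mul, hb0, mul_zero, sub_zero]
          rfl
        rw [h3]
        refine (enorm_integral_le_lintegral_enorm _).trans_eq ?_
        simp_rw [enorm_mul]
    _ = ∫⁻ w, ∫⁻ z in (cylinder κ (c * δ) w₀)ᶜ, ‖K z w - K z w₀‖ₑ * ‖b w‖ₑ := by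
        refine lintegral_lintegral_swap ?_
        exact hKm.enorm.aemeasurable.mul hb.1.enorm.comp_snd
    _ ≤ ∫⁻ w, A * ‖b w‖ₑ := by
        refine lintegral_mono fun w => ?_
        by_cases hw : w ∈ cylinder κ δ w₀
        · rw [lintegral_mul_const]
          · gcongr
            exact hH δ hδ w₀ w hw
          · exact (hKm.comp (measurable_id.prodMk measurable_const)).enorm
        · simp [hsupp w hw]
    _ = _ := lintegral_const_mul' _ _ ENNReal.coe_ne_top

lemma rpow_eq_rpow_sub_one_mul (x : ℝ≥0∞) {t : ℝ} (ht : 1 ≤ t) : x ^ t = x ^ (t - 1) * x := by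
  have h := ENNReal.rpow_add_of_nonneg (x := x) (t - 1) 1 (by linarith) zero_le_one
  rwa [sub_add_cancel, ENNReal.rpow_one] at h

lemma lintegral_enorm_rpow_le_of_ae_le {X : Type*} [MeasurableSpace X] {μ : Measure X}
    {g : X → ℝ} {M : ℝ≥0} (hM : ∀ᵐ w ∂μ, ‖g w‖ₑ ≤ M) {t : ℝ} (ht : 1 < t) :
    ∫⁻ w, ‖g w‖ₑ ^ t ∂μ ≤ (M : ℝ≥0∞) ^ (t - 1) * ∫⁻ w, ‖g w‖ₑ ∂μ := by
  rw [← lintegral_const_mul' _ _ (ENNReal.rpow_ne_top_of_nonneg (by linarith) ENNReal.coe_ne_top)]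
  refine lintegral_mono_ae ?_
  filter_upwards [hM] with w hw
  rw [rpow_eq_rpow_sub_one_mul _ ht.le]
  gcongr

lemma memLp_of_integrable_of_ae_le {X : Type*} [MeasurableSpace X] {μ : Measure X}
    {g : X → ℝ} (hg : Integrable g μ) {M : ℝ≥0} (hM : ∀ᵐ w ∂μ, ‖g w‖ₑ ≤ M) {q : ℝ≥0∞}
    (hq : 1 < q) : MemLp g q μ := by
  by_cases hqt : q = ∞
  · subst hqt
    exact memLp_top_of_bound_enorm hg.1 M hM
  · have ht : 1 < q.toReal := by
      rw [← ENNReal.toReal_one]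
      exact (ENNReal.toReal_lt_toReal ENNReal.one_ne_top hqt).2 hq
    refine ⟨hg.1, (eLpNorm_lt_top_iff_lintegral_rpow_enorm_lt_top
      (zero_lt_one.trans hq).ne' hqt).2 ?_⟩
    refine (lintegral_enorm_rpow_le_of_ae_le hM ht).trans_lt (ENNReal.mul_lt_top ?_ hg.2)
    exact ENNReal.rpow_lt_top_of_nonneg (by linarith) ENNReal.coe_ne_top

lemma DefinedAndBoundedOn.lintegral_rpow_le {q : ℝ≥0∞} (hq : 1 < q) (hqt : q ≠ ∞) {C : ℝ≥0}
    (hT : DefinedAndBoundedOn K q C) {g : SpaceTime d → ℝ} (hg : MemLp g q) :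
    ∫⁻ z, ‖integralOperator K g z‖ₑ ^ q.toReal ≤
      (C : ℝ≥0∞) ^ q.toReal * ∫⁻ w, ‖g w‖ₑ ^ q.toReal := by
  have hq0 : q ≠ 0 := (zero_lt_one.trans hq).ne'
  have ht0 : 0 < q.toReal := ENNReal.toReal_pos hq0 hqt
  have h3 := ENNReal.rpow_le_rpow (hT g hg).2 ht0.le
  rwa [ENNReal.mul_rpow_of_nonneg _ _ ht0.le, eLpNorm_eq_eLpNorm' hq0 hqt,
    eLpNorm_eq_eLpNorm' hq0 hqt, ← lintegral_rpow_enorm_eq_rpow_eLpNorm' ht0,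
    ← lintegral_rpow_enorm_eq_rpow_eLpNorm' ht0] at h3

lemma DefinedAndBoundedOn.ae_enorm_le {C : ℝ≥0}
    (hT : DefinedAndBoundedOn K ∞ C) {g : SpaceTime d → ℝ} (hg : MemLp g ∞) {M : ℝ≥0}
    (hM : ∀ᵐ w, ‖g w‖ₑ ≤ M) : ∀ᵐ z, ‖integralOperator K g z‖ₑ ≤ C * M := by
  have hTg := (hT g hg).2
  rw [eLpNorm_exponent_top, eLpNorm_exponent_top] at hTg
  filter_upwards [ae_le_eLpNormEssSup (f := integralOperator K g)] with z hz
  refine hz.trans (hTg.trans ?_)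
  gcongr
  exact eLpNormEssSup_le_of_ae_enorm_bound hM

/-- The bound for the good part. Since `C * M ≤ s`, it does not depend on `q`. -/
lemma DefinedAndBoundedOn.mul_meas_lt_le {q : ℝ≥0∞} (hq : 1 < q) {C : ℝ≥0}
    (hT : DefinedAndBoundedOn K q C) (hK : Measurable (Function.uncurry K))
    {g : SpaceTime d → ℝ} (hg : MemLp g q) {M s : ℝ≥0} (hs : 0 < s)
    (hM : ∀ᵐ w, ‖g w‖ₑ ≤ M) (hMs : C * M ≤ s) :
    (s : ℝ≥0∞) * volume {z | (s : ℝ≥0∞) < ‖integralOperator K g z‖ₑ} ≤ C * ∫⁻ w, ‖g w‖ₑ := by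
  have hMs' : (C : ℝ≥0∞) * M ≤ s := by exact_mod_cast hMs
  by_cases hqt : q = ∞
  · subst hqt
    have h4 : volume {z | (s : ℝ≥0∞) < ‖integralOperator K g z‖ₑ} = 0 := by
      rw [measure_eq_zero_iff_ae_notMem]
      filter_upwards [hT.ae_enorm_le hg hM] with z hz using not_lt.2 (hz.trans hMs')
    rw [h4, mul_zero]
    exact zero_le
  · set t := q.toReal with ht
    have ht1 : 1 < t := by
      rw [ht, ← ENNReal.toReal_one]
      exact (ENNReal.toReal_lt_toReal ENNReal.one_ne_top hqt).2 hq
    have ht0 : 0 < t := by linarith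
    have hs0 : (s : ℝ≥0∞) ≠ 0 := by exact_mod_cast hs.ne'
    have hpow : (s : ℝ≥0∞) ^ (t - 1) ≠ 0 := by
      rw [Ne, ENNReal.rpow_eq_zero_iff]
      simp [hs0]
    have hpow' : (s : ℝ≥0∞) ^ (t - 1) ≠ ∞ :=
      ENNReal.rpow_ne_top_of_nonneg (by linarith) ENNReal.coe_ne_top
    have hsplit : ∀ x : ℝ≥0∞, x ^ t = x ^ (t - 1) * x := fun x =>
      rpow_eq_rpow_sub_one_mul x ht1.le
    rw [← ENNReal.mul_le_mul_iff_right hpow hpow']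
    calc (s : ℝ≥0∞) ^ (t - 1) * (s * volume {z | (s : ℝ≥0∞) < ‖integralOperator K g z‖ₑ})
        = (s : ℝ≥0∞) ^ t * volume {z | (s : ℝ≥0∞) < ‖integralOperator K g z‖ₑ} := by
          rw [hsplit, mul_assoc]
      _ ≤ (s : ℝ≥0∞) ^ t * volume {z | (s : ℝ≥0∞) ^ t ≤ ‖integralOperator K g z‖ₑ ^ t} := by
          refine mul_le_mul_right (measure_mono fun z hz => ?_) _
          exact ENNReal.rpow_le_rpow (le_of_lt hz) ht0.le
      _ ≤ ∫⁻ z, ‖integralOperator K g z‖ₑ ^ t :=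
          mul_meas_ge_le_lintegral₀
            ((aestronglyMeasurable_integralOperator hK hg.1).enorm.pow_const _) _
      _ ≤ (C : ℝ≥0∞) ^ t * ∫⁻ w, ‖g w‖ₑ ^ t := hT.lintegral_rpow_le hq hqt hg
      _ ≤ (C : ℝ≥0∞) ^ t * ((M : ℝ≥0∞) ^ (t - 1) * ∫⁻ w, ‖g w‖ₑ) := by
          gcongr
          exact lintegral_enorm_rpow_le_of_ae_le hM ht1
      _ = (C * M : ℝ≥0∞) ^ (t - 1) * (C * ∫⁻ w, ‖g w‖ₑ) := by
          rw [hsplit, ENNReal.mul_rpow_of_nonneg _ _ (by linarith)]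
          ring
      _ ≤ _ := by gcongr

/-- The sum of the bad parts, integrated off the dilated cylinders of the decomposition. -/
lemma CZDecomposition.lintegral_integralOperator_le {D α : ℝ≥0} {f g : SpaceTime d → ℝ}
    {u : Set (SpaceTime d)} {δ : SpaceTime d → ℝ} {b : u → SpaceTime d → ℝ}
    (hcz : CZDecomposition κ D f α u δ g b) {c : ℝ} {A : ℝ≥0} (hH : HormanderCondition κ K c A)
    (hK : Measurable (Function.uncurry K))
    (hfi : ∀ᵐ z, Integrable (fun w => K z w * f w))
    (hgi : ∀ᵐ z, Integrable (fun w => K z w * g w)) :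
    ∫⁻ z in (⋃ i : u, cylinder κ (c * δ i) (i : SpaceTime d))ᶜ,
      ‖integralOperator K (f - g) z‖ₑ ≤ A * (2 * ∫⁻ w, ‖f w‖ₑ) := by
  have := hcz.countable.to_subtype
  set S := ⋃ i : u, cylinder κ (c * δ i) (i : SpaceTime d)
  have hKz : ∀ z, Measurable (K z) := fun z => hK.comp (measurable_const.prodMk measurable_id)
  have hbm : ∀ z i, AEStronglyMeasurable (fun w => K z w * b i w) := fun z i =>
    (hKz z).aestronglyMeasurable.mul (hcz.bad_integrable i).1
  -- Absolute convergence, almost everywhere, of the double sum for `T (∑ b i)`: the absolute values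
  -- of the bad parts add up to at most `|f| + |g|`, to which the hypothesis on `L_q` applies.
  have hfin : ∀ᵐ z, ∑' i, ∫⁻ w, ‖K z w * b i w‖ₑ < ∞ := by
    filter_upwards [hfi, hgi] with z hz hz'
    rw [← lintegral_tsum fun i => (hbm z i).enorm]
    calc ∫⁻ w, ∑' i, ‖K z w * b i w‖ₑ ≤ ∫⁻ w, (‖K z w * f w‖ₑ + ‖K z w * g w‖ₑ) := by
          refine lintegral_mono fun w => ?_
          simp_rw [enorm_mul]
          rw [ENNReal.tsum_mul_left, ← mul_add]
          gcongr
          exact hcz.tsum_bad_le w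
      _ = _ := lintegral_add_left' hz.1.enorm _
      _ < ∞ := ENNReal.add_lt_top.2 ⟨hz.2, hz'.2⟩
  have hint : ∀ i, ∀ᵐ z, Integrable (fun w => K z w * b i w) := fun i => by
    filter_upwards [hfin] with z hz
    exact ⟨hbm z i, (ENNReal.le_tsum i).trans_lt hz⟩
  have hsum : ∀ᵐ z, ‖integralOperator K (f - g) z‖ₑ ≤ ∑' i, ‖integralOperator K (b i) z‖ₑ := by
    filter_upwards [hfin] with z hz
    have h3 : integralOperator K (f - g) z = ∑' i, integralOperator K (b i) z := by
      have h4 : ∀ w, K z w * (f - g) w = ∑' i, K z w * b i w := fun w =>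
        ((hcz.hasSum_bad w).mul_left _).tsum_eq.symm
      simp only [integralOperator, h4]
      exact integral_tsum (hbm z) hz.ne
    rw [h3]
    exact enorm_tsum_le_tsum_enorm
  calc ∫⁻ z in Sᶜ, ‖integralOperator K (f - g) z‖ₑ
      ≤ ∫⁻ z in Sᶜ, ∑' i, ‖integralOperator K (b i) z‖ₑ :=
        lintegral_mono_ae (ae_restrict_of_ae hsum)
    _ = ∑' i, ∫⁻ z in Sᶜ, ‖integralOperator K (b i) z‖ₑ :=
        lintegral_tsum fun i => (aestronglyMeasurable_integralOperator hK
          (hcz.bad_integrable i).1).enorm.restrict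
    _ ≤ ∑' i, A * ∫⁻ w, ‖b i w‖ₑ := by
        refine ENNReal.tsum_le_tsum fun i => ?_
        refine le_trans (lintegral_mono_set (compl_subset_compl.2 (subset_iUnion _ i))) ?_
        exact hH.lintegral_integralOperator_le hK (hcz.radius_pos i) _ (hcz.bad_integrable i)
          (hcz.bad_support i) (hcz.integral_bad i) (hint i)
    _ ≤ _ := by
        rw [ENNReal.tsum_mul_left]
        gcongr
        exact hcz.lintegral_bad_le

/-- The constant in the weak type (1,1) estimate. -/
noncomputable def weakConst (d : ℕ) (l : ℝ → ℝ) (c N : ℝ) (C A : ℝ≥0) : ℝ≥0 :=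
  2 * C + 4 * A + 2 * (C + 1) * (1 + doublingConst d l N) ^ 2 * doublingConst d l c

/-- The weak type (1,1) estimate, with a constant independent of `q`: the height of the
decomposition is a multiple of `s` chosen so that the good part has `C |g| ≤ s / 2`. -/
theorem mul_meas_integralOperator_le (h1 : AssumptionA1 κ) (h2 : AssumptionA2 κ l) {N : ℝ}
    (hN : IsEngulfingFactor l N) {c : ℝ} (hc : 1 < c) {q : ℝ≥0∞} (hq : 1 < q) {C A : ℝ≥0}
    (hK : Measurable (Function.uncurry K)) (hT : DefinedAndBoundedOn K q C)
    (hH : HormanderCondition κ K c A) {f : SpaceTime d → ℝ} (hf : Integrable f)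
    (hfq : MemLp f q) {s : ℝ≥0} (hs : 0 < s) :
    (s : ℝ≥0∞) * volume {z | (s : ℝ≥0∞) < ‖integralOperator K f z‖ₑ} ≤
      weakConst d l c N C A * ∫⁻ w, ‖f w‖ₑ := by
  have hc0 : 0 < c := by linarith
  set D : ℝ≥0 := 1 + doublingConst d l N with hD
  set Dc := doublingConst d l c with hDc
  have hD0 : 0 < D := by positivity
  set α : ℝ≥0 := s / (2 * (C + 1) * D) with hα
  have hα0 : 0 < α := by positivity
  have hsα : s = 2 * (C + 1) * D * α := by
    rw [hα]
    field_simp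
  obtain ⟨u, δ, g, b, hcz⟩ := exists_czDecomposition h1 h2 hN hf hα0
  have := hcz.countable.to_subtype
  set I := ∫⁻ w, ‖f w‖ₑ with hI
  have hgM : ∀ᵐ w, ‖g w‖ₑ ≤ ((D * α : ℝ≥0) : ℝ≥0∞) := by
    filter_upwards [hcz.good_le] with w hw
    rwa [ENNReal.coe_mul]
  have hgi : Integrable g := ⟨hcz.good_meas, hcz.lintegral_good_le.trans_lt hf.2⟩
  have hgq : MemLp g q := memLp_of_integrable_of_ae_le hgi hgM hq
  have hgood : ((s / 2 : ℝ≥0) : ℝ≥0∞) *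
      volume {z | ((s / 2 : ℝ≥0) : ℝ≥0∞) < ‖integralOperator K g z‖ₑ} ≤ C * I := by
    refine (hT.mul_meas_lt_le hq hK hgq (half_pos hs) hgM ?_).trans ?_
    · have h4 : s / 2 = (C + 1) * (D * α) := by
        rw [hsα]
        field_simp
      rw [h4]
      gcongr
      exact le_self_add
    · gcongr
      exact hcz.lintegral_good_le
  set S := ⋃ i : u, cylinder κ (c * δ i) (i : SpaceTime d) with hS
  have hSm : MeasurableSet S := MeasurableSet.iUnion fun i => measurableSet_cylinder _ _
  have hbad : ((s / 2 : ℝ≥0) : ℝ≥0∞) * volume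
      ({z | ((s / 2 : ℝ≥0) : ℝ≥0∞) ≤ ‖integralOperator K (f - g) z‖ₑ} ∩ Sᶜ) ≤ A * (2 * I) := by
    rw [← Measure.restrict_apply' hSm.compl]
    exact (mul_meas_ge_le_lintegral₀ (aestronglyMeasurable_integralOperator hK
      (hf.1.sub hgi.1)).enorm.restrict _).trans
      (hcz.lintegral_integralOperator_le hH hK (hT f hfq).1 (hT g hgq).1)
  have hexc : (s : ℝ≥0∞) * volume S ≤ ((2 * (C + 1) * D ^ 2 * Dc : ℝ≥0) : ℝ≥0∞) * I := by
    calc (s : ℝ≥0∞) * volume S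
        ≤ s * ∑' i : u, Dc * volume (cylinder κ (δ i) (i : SpaceTime d)) := by
          gcongr
          refine (measure_iUnion_le _).trans (ENNReal.tsum_le_tsum fun i => ?_)
          have := hcz.radius_pos i
          exact volume_cylinder_le h1 h2 (by positivity) this hc0 le_rfl _ _
      _ = (2 * (C + 1) * D * Dc : ℝ≥0) *
            (α * ∑' i : u, volume (cylinder κ (δ i) (i : SpaceTime d))) := by
          rw [ENNReal.tsum_mul_left, hsα]
          push_cast
          ring
      _ ≤ (2 * (C + 1) * D * Dc : ℝ≥0) * (D * I) := by
          exact mul_le_mul_right hcz.volume_le _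
      _ = _ := by
          push_cast
          ring
  have hae : ∀ᵐ z, ‖integralOperator K f z‖ₑ ≤
      ‖integralOperator K g z‖ₑ + ‖integralOperator K (f - g) z‖ₑ := by
    filter_upwards [(hT f hfq).1, (hT g hgq).1] with z hz hz'
    have h3 : integralOperator K f z = integralOperator K g z + integralOperator K (f - g) z := by
      simp only [integralOperator, Pi.sub_apply, mul_sub]
      rw [integral_sub hz hz']
      ring
    rw [h3]
    exact enorm_add_le _ _
  have hs2 : ((s / 2 : ℝ≥0) : ℝ≥0∞) + ((s / 2 : ℝ≥0) : ℝ≥0∞) = s := by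
    rw [← ENNReal.coe_add, add_halves]
  have hsub : ∀ᵐ z, z ∈ {z | (s : ℝ≥0∞) < ‖integralOperator K f z‖ₑ} →
      z ∈ {z | ((s / 2 : ℝ≥0) : ℝ≥0∞) < ‖integralOperator K g z‖ₑ} ∪
        ({z | ((s / 2 : ℝ≥0) : ℝ≥0∞) ≤ ‖integralOperator K (f - g) z‖ₑ} ∩ Sᶜ ∪ S) := by
    filter_upwards [hae] with z hz hzs
    by_contra hcon
    simp only [mem_union, mem_inter_iff, mem_ofPred_eq, mem_compl_iff, not_or, not_and,
      not_not, not_lt] at hcon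
    obtain ⟨h3, h4, h5⟩ := hcon
    have h6 : ‖integralOperator K (f - g) z‖ₑ ≤ ((s / 2 : ℝ≥0) : ℝ≥0∞) := by
      by_contra h
      exact h5 (h4 (not_le.1 h).le)
    exact absurd (hz.trans (add_le_add h3 h6)) (not_le.2 (hs2 ▸ hzs))
  calc (s : ℝ≥0∞) * volume {z | (s : ℝ≥0∞) < ‖integralOperator K f z‖ₑ}
      ≤ s * (volume {z | ((s / 2 : ℝ≥0) : ℝ≥0∞) < ‖integralOperator K g z‖ₑ} +
        (volume ({z | ((s / 2 : ℝ≥0) : ℝ≥0∞) ≤ ‖integralOperator K (f - g) z‖ₑ} ∩ Sᶜ) +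
          volume S)) := by
        gcongr
        exact (measure_mono_ae hsub).trans ((measure_union_le _ _).trans
          (add_le_add_right (measure_union_le _ _) _))
    _ = 2 * (((s / 2 : ℝ≥0) : ℝ≥0∞) *
          volume {z | ((s / 2 : ℝ≥0) : ℝ≥0∞) < ‖integralOperator K g z‖ₑ}) +
        2 * (((s / 2 : ℝ≥0) : ℝ≥0∞) * volume
          ({z | ((s / 2 : ℝ≥0) : ℝ≥0∞) ≤ ‖integralOperator K (f - g) z‖ₑ} ∩ Sᶜ)) +
        s * volume S := by
        rw [← mul_assoc, ← mul_assoc, two_mul, hs2]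
        ring
    _ ≤ 2 * (C * I) + 2 * (A * (2 * I)) + ((2 * (C + 1) * D ^ 2 * Dc : ℝ≥0) : ℝ≥0∞) * I := by
        gcongr
    _ = _ := by
        rw [weakConst, ← hD, ← hDc]
        push_cast
        ring

end WeakType

/-! ### Interpolation with constants uniform in the upper exponent -/

section Interpolation

lemma lintegral_Ioi_rpow {a x : ℝ} (ha : a < -1) (hx : 0 < x) :
    ∫⁻ s in Ioi x, ENNReal.ofReal (s ^ a) = ENNReal.ofReal (x ^ (a + 1) / (-(a + 1))) := by
  rw [← ofReal_integral_eq_lintegral_ofReal (integrableOn_Ioi_rpow_of_lt ha hx),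
    integral_Ioi_rpow_of_lt ha hx]
  · congr 1
    rw [div_neg, neg_div]
  · filter_upwards [ae_restrict_mem measurableSet_Ioi] with s hs
    exact Real.rpow_nonneg (hx.trans hs).le _

lemma lintegral_Ioc_rpow {a x : ℝ} (ha : -1 < a) (hx : 0 ≤ x) :
    ∫⁻ s in Ioc 0 x, ENNReal.ofReal (s ^ a) = ENNReal.ofReal (x ^ (a + 1) / (a + 1)) := by
  have h3 := (intervalIntegral.intervalIntegrable_rpow' (a := 0) (b := x) ha).1
  rw [← ofReal_integral_eq_lintegral_ofReal h3, ← intervalIntegral.integral_of_le hx,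
    integral_rpow (Or.inl ha), Real.zero_rpow (by linarith), sub_zero]
  filter_upwards [ae_restrict_mem measurableSet_Ioc] with s hs
  exact Real.rpow_nonneg hs.1.le _

variable {p t γ : ℝ}

/-- Equality holds. The two regions `s ≤ x` and `x < s` contribute `1 / p` and `1 / (t - p)`; their
sum `t / (p * (t - p))` stays comparable to the constants of the other side both as `t → p` and as
`t → ∞`. -/
lemma mul_rpow_le_lintegral_min (hp : 0 < p) (hpt : p < t) {x : ℝ} (hx : 0 ≤ x) :
    ENNReal.ofReal (t / (p * (t - p)) * x ^ p) ≤
      ∫⁻ s in Ioi (0 : ℝ), ENNReal.ofReal (s ^ (p - t - 1)) * ENNReal.ofReal (min x s ^ t) := by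
  rcases hx.eq_or_lt with rfl | hx
  · simp [Real.zero_rpow hp.ne']
  have htp : 0 < t - p := by linarith
  have h3 : ∫⁻ s in Ioc 0 x, ENNReal.ofReal (s ^ (p - t - 1)) * ENNReal.ofReal (min x s ^ t) =
      ENNReal.ofReal (x ^ p / p) := by
    have := lintegral_Ioc_rpow (a := p - 1) (by linarith) hx.le
    rw [sub_add_cancel] at this
    rw [← this]
    refine setLIntegral_congr_fun measurableSet_Ioc fun s hs => ?_
    have hs0 := hs.1
    simp only [min_eq_right hs.2]
    rw [← ENNReal.ofReal_mul (by positivity), ← Real.rpow_add hs0]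
    congr 2
    ring
  have h4 : ∫⁻ s in Ioi x, ENNReal.ofReal (s ^ (p - t - 1)) * ENNReal.ofReal (min x s ^ t) =
      ENNReal.ofReal (x ^ p / (t - p)) := by
    have h5 : ∫⁻ s in Ioi x, ENNReal.ofReal (s ^ (p - t - 1)) * ENNReal.ofReal (min x s ^ t) =
        ∫⁻ s in Ioi x, ENNReal.ofReal (s ^ (p - t - 1)) * ENNReal.ofReal (x ^ t) :=
      setLIntegral_congr_fun measurableSet_Ioi fun s hs => by
        simp only [min_eq_left (le_of_lt (mem_Ioi.1 hs))]
    rw [h5, lintegral_mul_const' _ _ ENNReal.ofReal_ne_top,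
      lintegral_Ioi_rpow (by linarith) hx, ← ENNReal.ofReal_mul (by
        rw [show -(p - t - 1 + 1) = t - p by ring]; positivity)]
    congr 1
    rw [show -(p - t - 1 + 1) = t - p by ring, div_mul_eq_mul_div, ← Real.rpow_add hx]
    congr 2
    ring
  rw [← Ioc_union_Ioi_eq_Ioi hx.le, lintegral_union measurableSet_Ioi
    (Set.disjoint_left.2 fun s hs hs' => absurd hs.2 (not_le.2 hs')), h3, h4,
    ← ENNReal.ofReal_add (by positivity) (by positivity)]
  apply ENNReal.ofReal_le_ofReal
  apply le_of_eq
  field_simp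
  ring

lemma lintegral_large_le (hp : 1 < p) (hγ : 0 < γ) {x : ℝ} (hx : 0 ≤ x) :
    ∫⁻ s in Ioi (0 : ℝ), ENNReal.ofReal (s ^ (p - 2)) *
      (if γ * s < x then ENNReal.ofReal x else 0) ≤
      ENNReal.ofReal (γ ^ (1 - p) / (p - 1)) * ENNReal.ofReal (x ^ p) := by
  have hp1 : 0 < p - 1 := by linarith
  rcases hx.eq_or_lt with rfl | hx
  · simp
  calc ∫⁻ s in Ioi (0 : ℝ), ENNReal.ofReal (s ^ (p - 2)) *
        (if γ * s < x then ENNReal.ofReal x else 0)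
      ≤ ∫⁻ s in Ioi (0 : ℝ), (Ioc 0 (x / γ)).indicator
          (fun s => ENNReal.ofReal (s ^ (p - 2)) * ENNReal.ofReal x) s := by
        refine setLIntegral_mono' measurableSet_Ioi fun s hs => ?_
        by_cases h : γ * s < x
        · rw [if_pos h, indicator_of_mem]
          exact ⟨hs, (le_div_iff₀' hγ).2 h.le⟩
        · simp [if_neg h]
    _ ≤ ∫⁻ s, (Ioc 0 (x / γ)).indicator
          (fun s => ENNReal.ofReal (s ^ (p - 2)) * ENNReal.ofReal x) s :=
        setLIntegral_le_lintegral _ _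
    _ = ENNReal.ofReal ((x / γ) ^ (p - 1) / (p - 1)) * ENNReal.ofReal x := by
        rw [lintegral_indicator measurableSet_Ioc, lintegral_mul_const' _ _ ENNReal.ofReal_ne_top,
          lintegral_Ioc_rpow (by linarith) (by positivity), show p - 2 + 1 = p - 1 by ring]
    _ ≤ _ := by
        rw [← ENNReal.ofReal_mul (by positivity), ← ENNReal.ofReal_mul (by positivity)]
        apply ENNReal.ofReal_le_ofReal
        apply le_of_eq
        have h3 : x ^ p = x ^ (p - 1) * x := by
          rw [← Real.rpow_add_one hx.ne', sub_add_cancel]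
        rw [Real.div_rpow hx.le hγ.le, h3, show 1 - p = -(p - 1) by ring, Real.rpow_neg hγ.le]
        field_simp

lemma lintegral_small_le (hp : 0 < p) (hpt : p < t) (hγ : 0 < γ) {x : ℝ} (hx : 0 ≤ x) :
    ∫⁻ s in Ioi (0 : ℝ), ENNReal.ofReal (s ^ (p - t - 1)) *
      (if x ≤ γ * s then ENNReal.ofReal (x ^ t) else 0) ≤
      ENNReal.ofReal (γ ^ (t - p) / (t - p)) * ENNReal.ofReal (x ^ p) := by
  have htp : 0 < t - p := by linarith
  rcases hx.eq_or_lt with rfl | hx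
  · simp [Real.zero_rpow (hp.trans hpt).ne']
  have hxγ : 0 < x / γ := by positivity
  calc ∫⁻ s in Ioi (0 : ℝ), ENNReal.ofReal (s ^ (p - t - 1)) *
        (if x ≤ γ * s then ENNReal.ofReal (x ^ t) else 0)
      ≤ ∫⁻ s, (Ici (x / γ)).indicator
          (fun s => ENNReal.ofReal (s ^ (p - t - 1)) * ENNReal.ofReal (x ^ t)) s := by
        refine (setLIntegral_le_lintegral _ _).trans (lintegral_mono fun s => ?_)
        by_cases h : x ≤ γ * s
        · rw [if_pos h, indicator_of_mem]
          exact (div_le_iff₀' hγ).2 h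
        · simp [if_neg h]
    _ = ENNReal.ofReal ((x / γ) ^ (p - t) / (t - p)) * ENNReal.ofReal (x ^ t) := by
        rw [lintegral_indicator measurableSet_Ici, lintegral_mul_const' _ _ ENNReal.ofReal_ne_top,
          setLIntegral_congr Ioi_ae_eq_Ici.symm, lintegral_Ioi_rpow (by linarith) hxγ]
        congr 4 <;> ring
    _ ≤ _ := by
        rw [← ENNReal.ofReal_mul (by positivity), ← ENNReal.ofReal_mul (by positivity)]
        apply ENNReal.ofReal_le_ofReal
        apply le_of_eq
        have h3 : x ^ p = x ^ (p - t) * x ^ t := by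
          rw [← Real.rpow_add hx, sub_add_cancel]
        rw [Real.div_rpow hx.le hγ.le, h3, show t - p = -(p - t) by ring, Real.rpow_neg hγ.le]
        field_simp

variable {X : Type*} [MeasurableSpace X] {μ : Measure X}

/-- The part of the `L¹` norm of `f` that lies above the level `τ`. -/
noncomputable def upperMass (μ : Measure X) (f : X → ℝ) (τ : ℝ) : ℝ≥0∞ :=
  ∫⁻ x, if τ < |f x| then ENNReal.ofReal |f x| else 0 ∂μ

/-- The part of `∫ |f|ᵗ` that lies below the level `τ`. -/
noncomputable def lowerMass (μ : Measure X) (f : X → ℝ) (t τ : ℝ) : ℝ≥0∞ :=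
  ∫⁻ x, if |f x| ≤ τ then ENNReal.ofReal (|f x| ^ t) else 0 ∂μ

/-- Truncation at `s` makes a function of weak type (1,1) contribute to the `t`-th moment, by the
layer cake formula up to height `s`. -/
lemma lintegral_min_rpow_le (ht : 1 < t) {v : X → ℝ} (hv : AEMeasurable v μ) {J : ℝ≥0∞}
    (hw : ∀ s : ℝ, 0 < s → ENNReal.ofReal s * μ {x | s < |v x|} ≤ J) {s : ℝ} (hs : 0 < s) :
    ∫⁻ x, ENNReal.ofReal (min (2 * |v x|) s ^ t) ∂μ ≤
      ENNReal.ofReal (2 * t / (t - 1) * s ^ (t - 1)) * J := by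
  have ht1 : 0 < t - 1 := by linarith
  have hm : AEMeasurable (fun x => min (2 * |v x|) s) μ :=
    (hv.abs.const_mul _).min aemeasurable_const
  rw [lintegral_rpow_eq_lintegral_meas_lt_mul μ
    (Eventually.of_forall fun x => le_min (by positivity) hs.le) hm (by linarith)]
  calc ENNReal.ofReal t * ∫⁻ r in Ioi (0 : ℝ), μ {x | r < min (2 * |v x|) s} *
        ENNReal.ofReal (r ^ (t - 1))
      ≤ ENNReal.ofReal t * ∫⁻ r in Ioi (0 : ℝ), (Ioc 0 s).indicator
          (fun r => ENNReal.ofReal (r ^ (t - 2)) * (2 * J)) r := by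
        refine mul_le_mul_right (setLIntegral_mono' measurableSet_Ioi fun r hr => ?_) _
        have hr0 : 0 < r := hr
        by_cases hrs : r ≤ s
        · rw [indicator_of_mem (show r ∈ Ioc 0 s from ⟨hr, hrs⟩)]
          have h3 : μ {x | r < min (2 * |v x|) s} ≤ μ {x | r / 2 < |v x|} := by
            refine measure_mono fun x hx => ?_
            have h4 : r < min (2 * |v x|) s := hx
            have := h4.trans_le (min_le_left _ _)
            change r / 2 < |v x|
            linarith
          have h5 : ENNReal.ofReal (r ^ (t - 1)) =
              ENNReal.ofReal (r ^ (t - 2)) * (2 * ENNReal.ofReal (r / 2)) := by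
            rw [← ENNReal.ofReal_ofNat, ← ENNReal.ofReal_mul (by norm_num),
              ← ENNReal.ofReal_mul (by positivity), mul_div_cancel₀ _ two_ne_zero,
              ← Real.rpow_add_one hr0.ne']
            congr 2
            ring
          calc μ {x | r < min (2 * |v x|) s} * ENNReal.ofReal (r ^ (t - 1))
              ≤ μ {x | r / 2 < |v x|} *
                (ENNReal.ofReal (r ^ (t - 2)) * (2 * ENNReal.ofReal (r / 2))) := by
                rw [h5]
                exact mul_le_mul_left h3 _
            _ = ENNReal.ofReal (r ^ (t - 2)) *
                (2 * (ENNReal.ofReal (r / 2) * μ {x | r / 2 < |v x|})) := by ring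
            _ ≤ _ := by
                gcongr
                exact hw _ (by positivity)
        · have h3 : {x | r < min (2 * |v x|) s} = ∅ := by
            refine eq_empty_of_forall_notMem fun x hx => hrs ?_
            have h4 : r < min (2 * |v x|) s := hx
            exact (h4.trans_le (min_le_right _ _)).le
          rw [h3, measure_empty, zero_mul]
          exact zero_le
    _ ≤ ENNReal.ofReal t * ∫⁻ r, (Ioc 0 s).indicator
          (fun r => ENNReal.ofReal (r ^ (t - 2)) * (2 * J)) r :=
        mul_le_mul_right (setLIntegral_le_lintegral _ _) _
    _ = ENNReal.ofReal t * (ENNReal.ofReal (s ^ (t - 1) / (t - 1)) * (2 * J)) := by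
        rw [lintegral_indicator measurableSet_Ioc, lintegral_mul_const,
          lintegral_Ioc_rpow (by linarith) hs.le, show t - 2 + 1 = t - 1 by ring]
        fun_prop
    _ = _ := by
        rw [← ENNReal.ofReal_ofNat, ← mul_assoc, ← mul_assoc,
          ← ENNReal.ofReal_mul (by linarith), ← ENNReal.ofReal_mul (by positivity)]
        congr 2
        ring

variable [SFinite μ]

lemma lintegral_upperMass_le (hp : 1 < p) (hγ : 0 < γ) {f : X → ℝ} (hf : Measurable f) :
    ∫⁻ s in Ioi (0 : ℝ), ENNReal.ofReal (s ^ (p - 2)) * upperMass μ f (γ * s) ≤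
      ENNReal.ofReal (γ ^ (1 - p) / (p - 1)) * ∫⁻ x, ENNReal.ofReal (|f x| ^ p) ∂μ := by
  have hm : Measurable fun z : ℝ × X => ENNReal.ofReal (z.1 ^ (p - 2)) *
      (if γ * z.1 < |f z.2| then ENNReal.ofReal |f z.2| else 0) := by
    refine Measurable.mul (by fun_prop) (Measurable.ite ?_ (by fun_prop) measurable_const)
    exact measurableSet_lt (by fun_prop) (by fun_prop)
  calc ∫⁻ s in Ioi (0 : ℝ), ENNReal.ofReal (s ^ (p - 2)) * upperMass μ f (γ * s)
      = ∫⁻ s in Ioi (0 : ℝ), ∫⁻ x, ENNReal.ofReal (s ^ (p - 2)) *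
          (if γ * s < |f x| then ENNReal.ofReal |f x| else 0) ∂μ := by
        refine lintegral_congr fun s => ?_
        rw [upperMass, lintegral_const_mul' _ _ ENNReal.ofReal_ne_top]
    _ = ∫⁻ x, (∫⁻ s in Ioi (0 : ℝ), ENNReal.ofReal (s ^ (p - 2)) *
          (if γ * s < |f x| then ENNReal.ofReal |f x| else 0)) ∂μ :=
        lintegral_lintegral_swap hm.aemeasurable
    _ ≤ ∫⁻ x, ENNReal.ofReal (γ ^ (1 - p) / (p - 1)) * ENNReal.ofReal (|f x| ^ p) ∂μ :=
        lintegral_mono fun x => lintegral_large_le hp hγ (abs_nonneg _)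
    _ = _ := lintegral_const_mul' _ _ ENNReal.ofReal_ne_top

lemma lintegral_lowerMass_le (hp : 0 < p) (hpt : p < t) (hγ : 0 < γ) {f : X → ℝ}
    (hf : Measurable f) :
    ∫⁻ s in Ioi (0 : ℝ), ENNReal.ofReal (s ^ (p - t - 1)) * lowerMass μ f t (γ * s) ≤
      ENNReal.ofReal (γ ^ (t - p) / (t - p)) * ∫⁻ x, ENNReal.ofReal (|f x| ^ p) ∂μ := by
  have hm : Measurable fun z : ℝ × X => ENNReal.ofReal (z.1 ^ (p - t - 1)) *
      (if |f z.2| ≤ γ * z.1 then ENNReal.ofReal (|f z.2| ^ t) else 0) := by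
    refine Measurable.mul (by fun_prop) (Measurable.ite ?_ (by fun_prop) measurable_const)
    exact measurableSet_le (by fun_prop) (by fun_prop)
  calc ∫⁻ s in Ioi (0 : ℝ), ENNReal.ofReal (s ^ (p - t - 1)) * lowerMass μ f t (γ * s)
      = ∫⁻ s in Ioi (0 : ℝ), ∫⁻ x, ENNReal.ofReal (s ^ (p - t - 1)) *
          (if |f x| ≤ γ * s then ENNReal.ofReal (|f x| ^ t) else 0) ∂μ := by
        refine lintegral_congr fun s => ?_
        rw [lowerMass, lintegral_const_mul' _ _ ENNReal.ofReal_ne_top]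
    _ = ∫⁻ x, (∫⁻ s in Ioi (0 : ℝ), ENNReal.ofReal (s ^ (p - t - 1)) *
          (if |f x| ≤ γ * s then ENNReal.ofReal (|f x| ^ t) else 0)) ∂μ :=
        lintegral_lintegral_swap hm.aemeasurable
    _ ≤ ∫⁻ x, ENNReal.ofReal (γ ^ (t - p) / (t - p)) * ENNReal.ofReal (|f x| ^ p) ∂μ :=
        lintegral_mono fun x => lintegral_small_le hp hpt hγ (abs_nonneg _)
    _ = _ := lintegral_const_mul' _ _ ENNReal.ofReal_ne_top

/-- The constant in the interpolated bound on `∫ |u| ^ p`, where `W` is the weak type (1,1) constant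
and functions are cut at `γ` times the level. -/
noncomputable def interpConst (p γ W : ℝ) : ℝ := 2 * W * p * γ ^ (1 - p) / (p - 1) + γ ^ (-p)

/-- Interpolation between weak type (1,1) and a bound in `L^∞`. -/
theorem lintegral_rpow_le_of_weak_of_bound (hp : 1 < p) (hγ : 0 < γ) {W : ℝ} (hW : 0 ≤ W)
    {u f : X → ℝ} (hu : AEMeasurable u μ) (hf : Measurable f)
    (H : ∀ s : ℝ, 0 < s → ∃ v w : X → ℝ, (∀ᵐ x ∂μ, |u x| ≤ |v x| + |w x|) ∧
      (∀ r : ℝ, 0 < r →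
        ENNReal.ofReal r * μ {x | r < |v x|} ≤ ENNReal.ofReal W * upperMass μ f (γ * s)) ∧
      ∀ᵐ x ∂μ, |w x| ≤ s / 2) :
    ∫⁻ x, ENNReal.ofReal (|u x| ^ p) ∂μ ≤
      ENNReal.ofReal (interpConst p γ W) * ∫⁻ x, ENNReal.ofReal (|f x| ^ p) ∂μ := by
  have hp1 : 0 < p - 1 := by linarith
  rw [lintegral_rpow_eq_lintegral_meas_lt_mul μ (Eventually.of_forall fun x => abs_nonneg _)
    hu.abs (by linarith)]
  have hpt : ∀ s ∈ Ioi (0 : ℝ), μ {x | s < |u x|} * ENNReal.ofReal (s ^ (p - 1)) ≤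
      ENNReal.ofReal (2 * W) * (ENNReal.ofReal (s ^ (p - 2)) * upperMass μ f (γ * s)) := by
    intro s hs
    have hs0 : 0 < s := hs
    obtain ⟨v, w, huvw, hv, hw⟩ := H s hs
    have h3 : μ {x | s < |u x|} ≤ μ {x | s / 2 < |v x|} := by
      refine measure_mono_ae ?_
      filter_upwards [huvw, hw] with x h4 h5 h6
      have h7 : s < |u x| := h6
      change s / 2 < |v x|
      linarith
    have h5 : ENNReal.ofReal (s ^ (p - 1)) =
        ENNReal.ofReal (s ^ (p - 2)) * (2 * ENNReal.ofReal (s / 2)) := by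
      rw [← ENNReal.ofReal_ofNat, ← ENNReal.ofReal_mul (by norm_num),
        ← ENNReal.ofReal_mul (by positivity), mul_div_cancel₀ _ two_ne_zero,
        ← Real.rpow_add_one hs0.ne']
      congr 2
      ring
    calc μ {x | s < |u x|} * ENNReal.ofReal (s ^ (p - 1))
        ≤ μ {x | s / 2 < |v x|} *
          (ENNReal.ofReal (s ^ (p - 2)) * (2 * ENNReal.ofReal (s / 2))) := by
          rw [h5]
          exact mul_le_mul_left h3 _
      _ = ENNReal.ofReal (s ^ (p - 2)) *
          (2 * (ENNReal.ofReal (s / 2) * μ {x | s / 2 < |v x|})) := by ring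
      _ ≤ ENNReal.ofReal (s ^ (p - 2)) * (2 * (ENNReal.ofReal W * upperMass μ f (γ * s))) := by
          exact mul_le_mul_right (mul_le_mul_right (hv _ (by positivity)) _) _
      _ = _ := by
          rw [ENNReal.ofReal_mul zero_le_two, ENNReal.ofReal_ofNat]
          ring
  calc ENNReal.ofReal p * ∫⁻ s in Ioi (0 : ℝ), μ {x | s < |u x|} * ENNReal.ofReal (s ^ (p - 1))
      ≤ ENNReal.ofReal p * ∫⁻ s in Ioi (0 : ℝ),
          ENNReal.ofReal (2 * W) * (ENNReal.ofReal (s ^ (p - 2)) * upperMass μ f (γ * s)) :=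
        mul_le_mul_right (setLIntegral_mono' measurableSet_Ioi hpt) _
    _ ≤ ENNReal.ofReal p * (ENNReal.ofReal (2 * W) * (ENNReal.ofReal (γ ^ (1 - p) / (p - 1)) *
          ∫⁻ x, ENNReal.ofReal (|f x| ^ p) ∂μ)) := by
        rw [lintegral_const_mul' _ _ ENNReal.ofReal_ne_top]
        exact mul_le_mul_right (mul_le_mul_right (lintegral_upperMass_le hp hγ hf) _) _
    _ ≤ _ := by
        rw [← mul_assoc, ← mul_assoc, ← ENNReal.ofReal_mul (by linarith),
          ← ENNReal.ofReal_mul (by positivity)]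
        refine mul_le_mul_left (ENNReal.ofReal_le_ofReal ?_) _
        have h3 : 0 ≤ γ ^ (-p) := by positivity
        calc p * (2 * W) * (γ ^ (1 - p) / (p - 1)) = 2 * W * p * γ ^ (1 - p) / (p - 1) := by ring
          _ ≤ _ := by rw [interpConst]; linarith

lemma min_rpow_le_add (ht : 0 < t) {a b c s : ℝ} (ha : 0 ≤ a) (hb : 0 ≤ b) (hc : 0 ≤ c)
    (hs : 0 ≤ s) (h : a ≤ b + c) : min a s ^ t ≤ min (2 * b) s ^ t + (2 * c) ^ t := by
  have h1 : 0 ≤ min a s := le_min ha hs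
  have h2 : 0 ≤ min (2 * b) s := le_min (by positivity) hs
  rcases le_total b c with hbc | hbc
  · have h3 : min a s ≤ 2 * c := (min_le_left _ _).trans (by linarith)
    have := Real.rpow_le_rpow h1 h3 ht.le
    have := Real.rpow_nonneg h2 t
    linarith
  · have h3 : min a s ≤ min (2 * b) s := min_le_min_right _ (by linarith)
    have := Real.rpow_le_rpow h1 h3 ht.le
    have : 0 ≤ (2 * c) ^ t := by positivity
    linarith

/-- Interpolation between weak type (1,1) and strong type `t`. The bound does not depend on `t`:
strong type is used through `min |u| s ^ t` rather than through Chebyshev's inequality, which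
keeps the constant bounded as `t → p`, and `2 * C * γ ≤ 1` does so as `t → ∞`. -/
theorem lintegral_rpow_le_of_weak_of_strong (hp : 1 < p) (hpt : p < t) (hγ : 0 < γ) {W C : ℝ}
    (hW : 0 ≤ W) (hC : 0 ≤ C) (hCγ : 2 * C * γ ≤ 1) {u f : X → ℝ} (hu : AEMeasurable u μ)
    (hf : Measurable f)
    (H : ∀ s : ℝ, 0 < s → ∃ v w : X → ℝ, AEMeasurable v μ ∧
      (∀ᵐ x ∂μ, |u x| ≤ |v x| + |w x|) ∧
      (∀ r : ℝ, 0 < r →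
        ENNReal.ofReal r * μ {x | r < |v x|} ≤ ENNReal.ofReal W * upperMass μ f (γ * s)) ∧
      ∫⁻ x, ENNReal.ofReal (|w x| ^ t) ∂μ ≤ ENNReal.ofReal (C ^ t) * lowerMass μ f t (γ * s)) :
    ∫⁻ x, ENNReal.ofReal (|u x| ^ p) ∂μ ≤
      ENNReal.ofReal (interpConst p γ W) * ∫⁻ x, ENNReal.ofReal (|f x| ^ p) ∂μ := by
  have hp0 : 0 < p := by linarith
  have ht1 : 0 < t - 1 := by linarith
  have ht0 : 0 < t := by linarith
  have hp1 : 0 < p - 1 := by linarith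
  have htp : 0 < t - p := by linarith
  set I := ∫⁻ x, ENNReal.ofReal (|f x| ^ p) ∂μ with hI
  have hlevel : ∀ s ∈ Ioi (0 : ℝ),
      ENNReal.ofReal (s ^ (p - t - 1)) * ∫⁻ x, ENNReal.ofReal (min |u x| s ^ t) ∂μ ≤
      ENNReal.ofReal (2 * t / (t - 1) * W) *
        (ENNReal.ofReal (s ^ (p - 2)) * upperMass μ f (γ * s)) +
      ENNReal.ofReal ((2 * C) ^ t) *
        (ENNReal.ofReal (s ^ (p - t - 1)) * lowerMass μ f t (γ * s)) := by
    intro s hs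
    have hs0 : 0 < s := hs
    obtain ⟨v, w, hvm, huvw, hv, hw⟩ := H s hs
    have h3 : ∫⁻ x, ENNReal.ofReal (min |u x| s ^ t) ∂μ ≤
        ENNReal.ofReal (2 * t / (t - 1) * s ^ (t - 1)) *
          (ENNReal.ofReal W * upperMass μ f (γ * s)) +
        ENNReal.ofReal ((2 * C) ^ t) * lowerMass μ f t (γ * s) := by
      calc ∫⁻ x, ENNReal.ofReal (min |u x| s ^ t) ∂μ
          ≤ ∫⁻ x, (ENNReal.ofReal (min (2 * |v x|) s ^ t) +
              ENNReal.ofReal (2 ^ t) * ENNReal.ofReal (|w x| ^ t)) ∂μ := by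
            refine lintegral_mono_ae ?_
            filter_upwards [huvw] with x hx
            have h4 := min_rpow_le_add ht0 (abs_nonneg (u x)) (abs_nonneg (v x))
              (abs_nonneg (w x)) hs0.le hx
            rw [Real.mul_rpow zero_le_two (abs_nonneg _)] at h4
            rw [← ENNReal.ofReal_mul (by positivity), ← ENNReal.ofReal_add _ (by positivity)]
            · exact ENNReal.ofReal_le_ofReal h4
            · exact Real.rpow_nonneg (le_min (by positivity) hs0.le) _
        _ = (∫⁻ x, ENNReal.ofReal (min (2 * |v x|) s ^ t) ∂μ) +
              ENNReal.ofReal (2 ^ t) * ∫⁻ x, ENNReal.ofReal (|w x| ^ t) ∂μ := by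
            rw [lintegral_add_left', lintegral_const_mul' _ _ ENNReal.ofReal_ne_top]
            exact (((hvm.abs.const_mul _).min aemeasurable_const).pow_const _).ennreal_ofReal
        _ ≤ ENNReal.ofReal (2 * t / (t - 1) * s ^ (t - 1)) *
              (ENNReal.ofReal W * upperMass μ f (γ * s)) +
            ENNReal.ofReal (2 ^ t) * (ENNReal.ofReal (C ^ t) * lowerMass μ f t (γ * s)) :=
            add_le_add (lintegral_min_rpow_le (by linarith) hvm hv hs0)
              (mul_le_mul_right hw _)
        _ = _ := by
            rw [← mul_assoc (ENNReal.ofReal (2 ^ t)), ← ENNReal.ofReal_mul (by positivity),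
              ← Real.mul_rpow zero_le_two hC]
    refine (mul_le_mul_right h3 _).trans_eq ?_
    rw [mul_add]
    congr 1
    · rw [← mul_assoc, ← mul_assoc, ← mul_assoc, ← ENNReal.ofReal_mul (by positivity),
        ← ENNReal.ofReal_mul (by positivity), ← ENNReal.ofReal_mul (by positivity)]
      congr 2
      have h4 : s ^ (p - 2) = s ^ (p - t - 1) * s ^ (t - 1) := by
        rw [← Real.rpow_add hs0]
        congr 1
        ring
      rw [h4]
      ring
    · ring
  have hum : AEMeasurable (Function.uncurry fun (x : X) (s : ℝ) =>
      ENNReal.ofReal (s ^ (p - t - 1)) * ENNReal.ofReal (min |u x| s ^ t))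
      (μ.prod (volume.restrict (Ioi 0))) := by
    have hm : Measurable fun z : X × ℝ => ENNReal.ofReal (z.2 ^ (p - t - 1)) := by fun_prop
    refine hm.aemeasurable.mul ?_
    exact ((hu.comp_fst.abs.min measurable_snd.aemeasurable).pow_const _).ennreal_ofReal
  have main : ENNReal.ofReal (t / (p * (t - p))) * ∫⁻ x, ENNReal.ofReal (|u x| ^ p) ∂μ ≤
      ENNReal.ofReal (2 * t / (t - 1) * W * (γ ^ (1 - p) / (p - 1)) +
        (2 * C) ^ t * (γ ^ (t - p) / (t - p))) * I := by
    calc ENNReal.ofReal (t / (p * (t - p))) * ∫⁻ x, ENNReal.ofReal (|u x| ^ p) ∂μ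
        = ∫⁻ x, ENNReal.ofReal (t / (p * (t - p)) * |u x| ^ p) ∂μ := by
          rw [← lintegral_const_mul' _ _ ENNReal.ofReal_ne_top]
          refine lintegral_congr fun x => ?_
          rw [ENNReal.ofReal_mul (by positivity)]
      _ ≤ ∫⁻ x, (∫⁻ s in Ioi (0 : ℝ), ENNReal.ofReal (s ^ (p - t - 1)) *
            ENNReal.ofReal (min |u x| s ^ t)) ∂μ :=
          lintegral_mono fun x => mul_rpow_le_lintegral_min hp0 hpt (abs_nonneg _)
      _ = ∫⁻ s in Ioi (0 : ℝ), ENNReal.ofReal (s ^ (p - t - 1)) *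
            ∫⁻ x, ENNReal.ofReal (min |u x| s ^ t) ∂μ := by
          rw [lintegral_lintegral_swap hum]
          refine lintegral_congr fun s => ?_
          rw [lintegral_const_mul' _ _ ENNReal.ofReal_ne_top]
      _ ≤ ∫⁻ s in Ioi (0 : ℝ), (ENNReal.ofReal (2 * t / (t - 1) * W) *
            (ENNReal.ofReal (s ^ (p - 2)) * upperMass μ f (γ * s)) +
          ENNReal.ofReal ((2 * C) ^ t) *
            (ENNReal.ofReal (s ^ (p - t - 1)) * lowerMass μ f t (γ * s))) :=
          setLIntegral_mono' measurableSet_Ioi hlevel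
      _ = ENNReal.ofReal (2 * t / (t - 1) * W) *
            (∫⁻ s in Ioi (0 : ℝ), ENNReal.ofReal (s ^ (p - 2)) * upperMass μ f (γ * s)) +
          ENNReal.ofReal ((2 * C) ^ t) *
            ∫⁻ s in Ioi (0 : ℝ), ENNReal.ofReal (s ^ (p - t - 1)) * lowerMass μ f t (γ * s) := by
          rw [lintegral_add_left, lintegral_const_mul' _ _ ENNReal.ofReal_ne_top,
            lintegral_const_mul' _ _ ENNReal.ofReal_ne_top]
          have hm : Measurable fun s : ℝ => upperMass μ f (γ * s) := by
            refine Measurable.lintegral_prod_right' (f := fun z : ℝ × X =>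
              if γ * z.1 < |f z.2| then ENNReal.ofReal |f z.2| else 0) ?_
            refine Measurable.ite ?_ (by fun_prop) measurable_const
            exact measurableSet_lt (by fun_prop) (by fun_prop)
          fun_prop
      _ ≤ ENNReal.ofReal (2 * t / (t - 1) * W) * (ENNReal.ofReal (γ ^ (1 - p) / (p - 1)) * I) +
          ENNReal.ofReal ((2 * C) ^ t) * (ENNReal.ofReal (γ ^ (t - p) / (t - p)) * I) :=
          add_le_add (mul_le_mul_right (lintegral_upperMass_le hp hγ hf) _)
            (mul_le_mul_right (lintegral_lowerMass_le hp0 hpt hγ hf) _)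
      _ = _ := by
          rw [ENNReal.ofReal_add (by positivity) (by positivity), ENNReal.ofReal_mul
            (p := 2 * t / (t - 1) * W) (by positivity),
            ENNReal.ofReal_mul (p := (2 * C) ^ t) (by positivity)]
          ring
  set k := t / (p * (t - p)) with hk
  have hk0 : 0 < k := by positivity
  have hkI := mul_le_mul_right main (ENNReal.ofReal k⁻¹)
  rw [← mul_assoc, ← mul_assoc, ← ENNReal.ofReal_mul (by positivity),
    ← ENNReal.ofReal_mul (by positivity), inv_mul_cancel₀ hk0.ne', ENNReal.ofReal_one,
    one_mul] at hkI
  refine hkI.trans (mul_le_mul_left (ENNReal.ofReal_le_ofReal ?_) _)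
  have hkinv : k⁻¹ = p * (t - p) / t := by rw [hk, inv_div]
  rw [hkinv, interpConst, mul_add]
  apply add_le_add
  · calc p * (t - p) / t * (2 * t / (t - 1) * W * (γ ^ (1 - p) / (p - 1)))
        = (t - p) / (t - 1) * (2 * W * p * γ ^ (1 - p) / (p - 1)) := by field_simp
      _ ≤ 1 * (2 * W * p * γ ^ (1 - p) / (p - 1)) := by
          gcongr
          exact (div_le_one ht1).2 (by linarith)
      _ = _ := one_mul _
  · calc p * (t - p) / t * ((2 * C) ^ t * (γ ^ (t - p) / (t - p)))
        = p / t * ((2 * C * γ) ^ t * γ ^ (-p)) := by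
          rw [Real.mul_rpow (by positivity) hγ.le,
            show γ ^ (t - p) = γ ^ t * γ ^ (-p) by rw [← Real.rpow_add hγ, sub_eq_add_neg]]
          field_simp
      _ ≤ 1 * (1 * γ ^ (-p)) := by
          gcongr
          · exact (div_le_one ht0).2 hpt.le
          · exact Real.rpow_le_one (by positivity) hCγ ht0.le
      _ = _ := by ring

end Interpolation

/-! ### Strong type bounds for the integral operator -/

lemma enorm_rpow_eq_ofReal_abs_rpow (x : ℝ) {t : ℝ} (ht : 0 ≤ t) :
    ‖x‖ₑ ^ t = ENNReal.ofReal (|x| ^ t) := by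
  rw [Real.enorm_eq_ofReal_abs, ENNReal.ofReal_rpow_of_nonneg (abs_nonneg _) ht]

lemma lintegral_enorm_indicator_lt {X : Type*} [MeasurableSpace X] (μ : Measure X) (f : X → ℝ)
    (τ : ℝ) : ∫⁻ x, ‖{x | τ < |f x|}.indicator f x‖ₑ ∂μ = upperMass μ f τ := by
  refine lintegral_congr fun x => ?_
  by_cases h : τ < |f x|
  · rw [indicator_of_mem (show x ∈ {x | τ < |f x|} from h), if_pos h, Real.enorm_eq_ofReal_abs]
  · rw [indicator_of_notMem (show x ∉ {x | τ < |f x|} from h), if_neg h, enorm_zero]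

lemma lintegral_indicator_compl_rpow {X : Type*} [MeasurableSpace X] (μ : Measure X) (f : X → ℝ)
    (τ : ℝ) {t : ℝ} (ht : 0 < t) :
    ∫⁻ x, ‖{x | τ < |f x|}ᶜ.indicator f x‖ₑ ^ t ∂μ = lowerMass μ f t τ := by
  refine lintegral_congr fun x => ?_
  by_cases h : τ < |f x|
  · rw [indicator_of_notMem (show x ∉ {x | τ < |f x|}ᶜ from fun h' => h' h),
      if_neg (not_le.2 h), enorm_zero, ENNReal.zero_rpow_of_pos ht]
  · rw [indicator_of_mem (show x ∈ {x | τ < |f x|}ᶜ from h), if_pos (not_lt.1 h),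
      enorm_rpow_eq_ofReal_abs_rpow _ ht.le]

lemma upperMass_lt_top {X : Type*} [MeasurableSpace X] {μ : Measure X} {f : X → ℝ} {p τ : ℝ}
    (hp : 1 < p) (hτ : 0 < τ) (hf : ∫⁻ x, ENNReal.ofReal (|f x| ^ p) ∂μ < ∞) :
    upperMass μ f τ < ∞ := by
  calc upperMass μ f τ ≤ ∫⁻ x, ENNReal.ofReal (τ ^ (1 - p)) * ENNReal.ofReal (|f x| ^ p) ∂μ := by
        refine lintegral_mono fun x => ?_
        by_cases h : τ < |f x|
        · have hx : 0 < |f x| := hτ.trans h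
          rw [if_pos h, ← ENNReal.ofReal_mul (by positivity)]
          apply ENNReal.ofReal_le_ofReal
          calc |f x| = |f x| ^ (1 - p) * |f x| ^ p := by
                rw [← Real.rpow_add hx, sub_add_cancel, Real.rpow_one]
            _ ≤ _ := by
                gcongr ?_ * _
                exact Real.rpow_le_rpow_of_nonpos hτ h.le (by linarith)
        · simp [if_neg h]
    _ = ENNReal.ofReal (τ ^ (1 - p)) * ∫⁻ x, ENNReal.ofReal (|f x| ^ p) ∂μ :=
        lintegral_const_mul' _ _ ENNReal.ofReal_ne_top
    _ < ∞ := ENNReal.mul_lt_top ENNReal.ofReal_lt_top hf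

section StrongType

variable {d : ℕ} {κ l : ℝ → ℝ} {K : SpaceTime d → SpaceTime d → ℝ}

/-- At each level `s` the function is cut where `|f| = γ s`: the weak type (1,1) estimate applies to
the large part and the bound on `L_q` to the small part. The choice of `γ` makes `2 C γ ≤ 1`, as the
interpolation requires. -/
lemma lintegral_integralOperator_rpow_le (h1 : AssumptionA1 κ) (h2 : AssumptionA2 κ l) {N : ℝ}
    (hN : IsEngulfingFactor l N) {c : ℝ} (hc : 1 < c) {q : ℝ≥0∞} {C A : ℝ≥0}
    (hK : Measurable (Function.uncurry K)) (hT : DefinedAndBoundedOn K q C)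
    (hH : HormanderCondition κ K c A) {p : ℝ} (hp : 1 < p) (hpq : ENNReal.ofReal p < q)
    {f : SpaceTime d → ℝ} (hfm : Measurable f)
    (hfp : ∫⁻ x, ENNReal.ofReal (|f x| ^ p) < ∞) (hfq : MemLp f q) :
    ∫⁻ z, ENNReal.ofReal (|integralOperator K f z| ^ p) ≤
      ENNReal.ofReal (interpConst p (1 / (2 * (C + 1))) (weakConst d l c N C A)) *
        ∫⁻ x, ENNReal.ofReal (|f x| ^ p) := by
  have hq1 : 1 < q := by
    refine lt_trans ?_ hpq
    rw [← ENNReal.ofReal_one]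
    exact (ENNReal.ofReal_lt_ofReal_iff (by linarith)).2 hp
  set γ : ℝ := 1 / (2 * (C + 1)) with hγ
  have hγ0 : 0 < γ := by positivity
  have hCγ : 2 * C * γ ≤ 1 := by
    rw [hγ, mul_one_div, div_le_one (by positivity)]
    linarith
  set W := weakConst d l c N C A
  set S : ℝ → Set (SpaceTime d) := fun s => {x | γ * s < |f x|} with hS
  have hSm : ∀ s, MeasurableSet (S s) := fun s => measurableSet_lt (by fun_prop) (by fun_prop)
  have hq0 : ∀ s, MemLp ((S s).indicator f) q := fun s => hfq.indicator (hSm s)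
  have hq0' : ∀ s, MemLp ((S s)ᶜ.indicator f) q := fun s => hfq.indicator (hSm s).compl
  have hsplit : ∀ s, ∀ᵐ z, |integralOperator K f z| ≤
      |integralOperator K ((S s).indicator f) z| +
        |integralOperator K ((S s)ᶜ.indicator f) z| := by
    intro s
    filter_upwards [(hT _ (hq0 s)).1, (hT _ (hq0' s)).1] with z hz hz'
    have h3 : integralOperator K f z = integralOperator K ((S s).indicator f) z +
        integralOperator K ((S s)ᶜ.indicator f) z := by
      simp only [integralOperator]
      rw [← integral_add hz hz']
      refine integral_congr_ae (Eventually.of_forall fun w => ?_)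
      have h4 : (S s).indicator f w + (S s)ᶜ.indicator f w = f w :=
        congrFun (indicator_self_add_compl (S s) f) w
      simp only [← mul_add, h4]
    rw [h3]
    exact abs_add_le _ _
  have hweak : ∀ s : ℝ, 0 < s → ∀ r : ℝ, 0 < r →
      ENNReal.ofReal r * volume {z | r < |integralOperator K ((S s).indicator f) z|} ≤
        ENNReal.ofReal (W : ℝ) * upperMass volume f (γ * s) := by
    intro s hs r hr
    have hmass := lintegral_enorm_indicator_lt volume f (γ * s)
    have hint : Integrable ((S s).indicator f) := by
      refine ⟨(hfm.indicator (hSm s)).aestronglyMeasurable, ?_⟩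
      rw [hasFiniteIntegral_iff_enorm, hmass]
      exact upperMass_lt_top hp (by positivity) hfp
    have h3 := mul_meas_integralOperator_le h1 h2 hN hc hq1 hK hT hH hint (hq0 s)
      (Real.toNNReal_pos.2 hr)
    rw [hmass] at h3
    rw [ENNReal.ofReal_coe_nnreal]
    refine le_trans (le_of_eq ?_) h3
    congr 3
    ext z
    rw [ENNReal.ofNNReal_toNNReal, Real.enorm_eq_ofReal_abs,
      ENNReal.ofReal_lt_ofReal_iff_of_nonneg hr.le]
  have hTm : ∀ {g : SpaceTime d → ℝ}, MemLp g q → AEMeasurable (integralOperator K g) :=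
    fun hg => (aestronglyMeasurable_integralOperator hK hg.1).aemeasurable
  by_cases hqt : q = ∞
  · subst hqt
    refine lintegral_rpow_le_of_weak_of_bound hp hγ0 W.coe_nonneg (hTm hfq) hfm fun s hs =>
      ⟨_, _, hsplit s, hweak s hs, ?_⟩
    have hM : ∀ᵐ w, ‖(S s)ᶜ.indicator f w‖ₑ ≤ ((γ * s).toNNReal : ℝ≥0∞) := by
      refine Eventually.of_forall fun w => ?_
      rw [ENNReal.ofNNReal_toNNReal, Real.enorm_eq_ofReal_abs]
      apply ENNReal.ofReal_le_ofReal
      by_cases h : w ∈ S s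
      · rw [indicator_of_notMem (show w ∉ (S s)ᶜ from fun h' => h' h), abs_zero]
        positivity
      · rw [indicator_of_mem (show w ∈ (S s)ᶜ from h)]
        exact not_lt.1 h
    filter_upwards [hT.ae_enorm_le (hq0' s) hM] with z hz
    rw [ENNReal.ofNNReal_toNNReal, Real.enorm_eq_ofReal_abs, ← ENNReal.ofReal_coe_nnreal,
      ← ENNReal.ofReal_mul C.coe_nonneg, ENNReal.ofReal_le_ofReal_iff (by positivity)] at hz
    refine hz.trans ?_
    nlinarith
  · have hpt : p < q.toReal := by
      rw [← ENNReal.ofReal_lt_ofReal_iff_of_nonneg (by linarith), ENNReal.ofReal_toReal hqt]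
      exact hpq
    have ht0 : 0 < q.toReal := by linarith
    refine lintegral_rpow_le_of_weak_of_strong hp hpt hγ0 W.coe_nonneg C.coe_nonneg hCγ
      (hTm hfq) hfm fun s hs => ⟨_, _, hTm (hq0 s), hsplit s, hweak s hs, ?_⟩
    have h3 := hT.lintegral_rpow_le hq1 hqt (hq0' s)
    rw [lintegral_indicator_compl_rpow volume f (γ * s) ht0] at h3
    simp_rw [enorm_rpow_eq_ofReal_abs_rpow _ ht0.le] at h3
    rwa [← ENNReal.ofReal_coe_nnreal, ENNReal.ofReal_rpow_of_nonneg C.coe_nonneg ht0.le] at h3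

lemma eLpNorm_integralOperator_le (h1 : AssumptionA1 κ) (h2 : AssumptionA2 κ l) {N : ℝ}
    (hN : IsEngulfingFactor l N) {c : ℝ} (hc : 1 < c) {p q : ℝ≥0∞} {C A : ℝ≥0}
    (hK : Measurable (Function.uncurry K)) (hT : DefinedAndBoundedOn K q C)
    (hH : HormanderCondition κ K c A) (hp : 1 < p) (hpq : p < q)
    {f : SpaceTime d → ℝ} (hfp : MemLp f p) (hfq : MemLp f q) :
    eLpNorm (integralOperator K f) p volume ≤
      (((interpConst p.toReal (1 / (2 * (C + 1))) (weakConst d l c N C A)).toNNReal ^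
        (1 / p.toReal) : ℝ≥0) : ℝ≥0∞) * eLpNorm f p volume := by
  have hpt : p ≠ ∞ := hpq.ne_top
  have hp0 : p ≠ 0 := (zero_lt_one.trans hp).ne'
  have hp1 : 1 < p.toReal := by
    rw [← ENNReal.toReal_one]
    exact (ENNReal.toReal_lt_toReal ENNReal.one_ne_top hpt).2 hp
  have hpos : 0 < p.toReal := by linarith
  set g := hfp.1.aemeasurable.mk f with hg
  have hgm : Measurable g := hfp.1.aemeasurable.measurable_mk
  have hfg : f =ᵐ[volume] g := hfp.1.aemeasurable.ae_eq_mk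
  have hTfg : integralOperator K f = integralOperator K g := by
    funext z
    refine integral_congr_ae ?_
    filter_upwards [hfg] with w hw
    rw [hw]
  have hgp : MemLp g p := (memLp_congr_ae hfg).1 hfp
  have hgq : MemLp g q := (memLp_congr_ae hfg).1 hfq
  have hgfin : ∫⁻ x, ENNReal.ofReal (|g x| ^ p.toReal) < ∞ := by
    have h3 := (eLpNorm_lt_top_iff_lintegral_rpow_enorm_lt_top hp0 hpt).1 hgp.2
    simpa only [enorm_rpow_eq_ofReal_abs_rpow _ hpos.le] using h3
  have h3 := lintegral_integralOperator_rpow_le h1 h2 hN hc hK hT hH hp1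
    (by rwa [ENNReal.ofReal_toReal hpt]) hgm hgfin hgq
  rw [hTfg, eLpNorm_congr_ae hfg, eLpNorm_eq_lintegral_rpow_enorm_toReal hp0 hpt,
    eLpNorm_eq_lintegral_rpow_enorm_toReal hp0 hpt,
    ENNReal.coe_rpow_of_nonneg _ (by positivity), ← ENNReal.mul_rpow_of_nonneg _ _ (by positivity)]
  simp_rw [enorm_rpow_eq_ofReal_abs_rpow _ hpos.le]
  exact ENNReal.rpow_le_rpow h3 (by positivity)

end StrongType

theorem mainTheorem4 (d : ℕ) (l : ℝ → ℝ) (c : ℝ) (hc : 1 < c) (C A : ℝ≥0)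
    (p : ℝ≥0∞) (hp : 1 < p) :
    ∃ Ap : ℝ≥0, ∀ (κ : ℝ → ℝ) (q : ℝ≥0∞) (K : SpaceTime d → SpaceTime d → ℝ),
      p < q → AssumptionA1 κ → AssumptionA2 κ l →
      Measurable (Function.uncurry K) →
      DefinedAndBoundedOn K q C → HormanderCondition κ K c A →
      ∀ f : SpaceTime d → ℝ, MemLp f p volume → MemLp f q volume →
        MemLp (integralOperator K f) p volume ∧
          eLpNorm (integralOperator K f) p volume ≤ Ap * eLpNorm f p volume := by
  by_cases hl : Tendsto l (𝓝[>] 0) (𝓝 0)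
  · obtain ⟨N, hN⟩ := exists_isEngulfingFactor hl
    refine ⟨(interpConst p.toReal (1 / (2 * (C + 1))) (weakConst d l c N C A)).toNNReal ^
      (1 / p.toReal), fun κ q K hpq h1 h2 hK hT hH f hfp hfq => ?_⟩
    have hbound := eLpNorm_integralOperator_le h1 h2 hN hc hK hT hH hp hpq hfp hfq
    exact ⟨⟨aestronglyMeasurable_integralOperator hK hfp.1,
      hbound.trans_lt (ENNReal.mul_lt_top ENNReal.coe_lt_top hfp.2)⟩, hbound⟩
  · -- No `κ` satisfies the scaling condition with such an `l`.
    exact ⟨0, fun κ q K _ _ h2 => absurd h2.tendsto_zero hl⟩
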